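/- Let $\mathcal C=[0,1]\times S^1$ be the closed cylinder, where $S^1=\{z\in\mathbb C : |z|=1\}$, let $s$ be the involution $(t,z)\mapsto(1-t,e^{i\pi}z)$ of $\mathcal C$, and let $\mathcal M=\mathcal C/s$ be the Möbius band; both are regarded as compact smooth surfaces with boundary, the structure on $\mathcal M$ being the one for which the projection $\mathcal C\to\mathcal M$ is a local diffeomorphism. Let $X$ be either $\mathcal C$ or $\mathcal M$, and let the circle group $S^1$ act on $X$ so that the action map $S^1\times X\to X$ is of class $C^1$, the action is faithful, and no point of $X$ is fixed by the whole group $S^1$. Then the action is conjugate to the standard action of $S^1$ by rotations, given by $$e^{i\theta}\cdot(t,z)=(t,e^{i\theta}z)$$ on $\mathcal C$, and by the induced action $e^{i\theta}\cdot[(t,z)]=[(t,e^{i\theta}z)]$ on $\mathcal M$ (which is well defined because rotations commute with $s$). That is, there is a $C^1$ diffeomorphism $\psi:X\to X$ such that $\psi(g\cdot x)=g*\psi(x)$ for all $g\in S^1$ and $x\in X$, where $\cdot$ is the standard action and $*$ is the given one. -/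

import Mathlib

open scoped Manifold ContDiff

noncomputable section

/-- The closed cylinder `[0,1] × S¹`, with Mathlib's structure of a manifold with boundary. -/
abbrev Cylinder : Type := Set.Icc (0 : ℝ) 1 × Circle

/-- The model of surfaces with boundary on which the cylinder is modelled. -/
abbrev cylModel := (𝓡∂ 1).prod (𝓡 1)

/-- The involution `s (t, z) = (1 - t, e^{iπ} z)` of the cylinder. -/
def cylInvol (p : Cylinder) : Cylinder := (unitInterval.symm p.1, Circle.exp Real.pi * p.2)

/-- The standard rotation action on the cylinder: `g · (t, z) = (t, g z)`. -/
def cylRotation (g : Circle) (p : Cylinder) : Cylinder := (p.1, g * p.2)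

theorem exp_pi_mul_self : Circle.exp Real.pi * Circle.exp Real.pi = 1 := by
  rw [← Circle.exp_add, ← two_mul, Circle.exp_two_pi]

theorem cylInvol_cylInvol (p : Cylinder) : cylInvol (cylInvol p) = p := by
  ext1
  · simp [cylInvol]
  · simp [cylInvol, ← mul_assoc, exp_pi_mul_self]

theorem cylInvol_cylRotation (g : Circle) (p : Cylinder) :
    cylInvol (cylRotation g p) = cylRotation g (cylInvol p) := by
  simp [cylInvol, cylRotation, mul_left_comm]

/-- Two points of the cylinder are identified when they are equal or exchanged by the involution. -/
instance mobiusSetoid : Setoid Cylinder where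
  r p q := q = p ∨ q = cylInvol p
  iseqv :=
    { refl := fun _ => Or.inl rfl
      symm := by
        rintro p q (rfl | rfl)
        · exact Or.inl rfl
        · exact Or.inr (cylInvol_cylInvol p).symm
      trans := by
        rintro p q r (rfl | rfl) (rfl | rfl)
        · exact Or.inl rfl
        · exact Or.inr rfl
        · exact Or.inr rfl
        · exact Or.inl (cylInvol_cylInvol p) }

/-- The Möbius band, the quotient of the cylinder by the involution `s`. -/
def Mobius : Type := Quotient mobiusSetoid

namespace Mobius

/-- The quotient topology. -/
instance : TopologicalSpace Mobius := inferInstanceAs (TopologicalSpace (Quotient mobiusSetoid))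

/-- The projection of the cylinder onto the Möbius band. -/
def proj (p : Cylinder) : Mobius := Quotient.mk mobiusSetoid p

theorem proj_surjective : Function.Surjective proj := Quotient.mk_surjective

theorem proj_eq_iff {p q : Cylinder} : proj p = proj q ↔ q = p ∨ q = cylInvol p := Quotient.eq

/-- The rotation action on the Möbius band, induced by that on the cylinder:
`g · [(t, z)] = [(t, g z)]`. -/
def rotation (g : Circle) : Mobius → Mobius :=
  Quotient.map (cylRotation g) (by
    rintro p q (rfl | rfl)
    · exact Or.inl rfl
    · exact Or.inr (cylInvol_cylRotation g p).symm)

theorem rotation_proj (g : Circle) (p : Cylinder) :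
    rotation g (proj p) = proj (cylRotation g p) := rfl

theorem continuous_cylInvol : Continuous cylInvol := by
  unfold cylInvol
  fun_prop

theorem continuous_proj : Continuous proj := continuous_quotient_mk'

theorem isOpenMap_proj : IsOpenMap proj := by
  intro U hU
  have h : proj ⁻¹' (proj '' U) = U ∪ cylInvol ⁻¹' U := by
    ext p
    simp only [Set.mem_preimage, Set.mem_image, Set.mem_union, proj_eq_iff]
    constructor
    · rintro ⟨q, hq, rfl | rfl⟩
      · exact Or.inl hq
      · exact Or.inr (by rwa [cylInvol_cylInvol])
    · rintro (h | h)
      · exact ⟨p, h, Or.inl rfl⟩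
      · exact ⟨_, h, Or.inr (cylInvol_cylInvol p).symm⟩
  have h2 : IsOpen (proj ⁻¹' (proj '' U)) := by
    rw [h]
    exact hU.union (hU.preimage continuous_cylInvol)
  exact isQuotientMap_quotient_mk'.isOpen_preimage.mp h2

theorem coe_exp_pi_mul (z : Circle) : ((Circle.exp Real.pi * z : Circle) : ℂ) = -z := by
  simp

/-- The projection is injective on the set of points whose second coordinate is at distance less
than `1` from that of `p`. -/
theorem injOn_proj (p : Cylinder) : Set.InjOn proj {q | dist q.2 p.2 < 1} := by
  intro q hq r hr h
  rcases proj_eq_iff.mp h with h | h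
  · exact h.symm
  · exfalso
    simp only [Set.mem_ofPred_eq, h] at hq hr
    have h1 : dist q.2 (cylInvol q).2 = 2 := by
      change dist (q.2 : ℂ) ((Circle.exp Real.pi * q.2 : Circle) : ℂ) = 2
      rw [coe_exp_pi_mul, dist_eq_norm]
      rw [sub_neg_eq_add, ← two_mul, norm_mul, Circle.norm_coe]
      simp
    have := dist_triangle_right q.2 (cylInvol q).2 p.2
    linarith

theorem isLocalHomeomorph_proj : IsLocalHomeomorph proj := by
  rw [isLocalHomeomorph_iff_isOpenEmbedding_restrict]
  intro p
  have hU : IsOpen {q : Cylinder | dist q.2 p.2 < 1} :=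
    isOpen_lt (by fun_prop) continuous_const
  refine ⟨_, hU.mem_nhds (by simp), ?_⟩
  exact .of_continuous_injective_isOpenMap (continuous_proj.comp continuous_subtype_val)
    (Set.injOn_iff_injective.mp (injOn_proj p)) (isOpenMap_proj.comp hU.isOpenMap_subtype_val)

/-- The charts of the Möbius band are the local inverses of the projection followed by the charts
of the cylinder. -/
instance : ChartedSpace (ModelProd (EuclideanHalfSpace 1) (EuclideanSpace ℝ (Fin 1))) Mobius :=
  isLocalHomeomorph_proj.chartedSpace proj_surjective

theorem contMDiff_cylInvol {n : WithTop ℕ∞} : ContMDiff cylModel cylModel n cylInvol := by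
  refine ContMDiff.prodMk (f := fun p : Cylinder => unitInterval.symm p.1)
    (g := fun p : Cylinder => Circle.exp Real.pi * p.2) ?_ ?_
  · rw [contMDiff_iff_comp_subtypeVal_Icc]
    have h : ContMDiff cylModel 𝓘(ℝ, ℝ) n (fun p : Cylinder => (p.1 : ℝ)) :=
      contMDiff_subtypeVal_Icc.comp contMDiff_fst
    exact ⟨by fun_prop, contMDiff_const.sub h⟩
  · exact contMDiff_const.mul contMDiff_snd

/-- The charts are compatible: the changes of charts are those of the cylinder composed with the
identity or with the involution. -/
instance {n : WithTop ℕ∞} : IsManifold cylModel n Mobius := by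
  apply isManifold_of_contDiffOn
  rintro _ _ ⟨a', rfl⟩ ⟨b', rfl⟩ y ⟨hy, hyr⟩
  generalize (proj_surjective.hasRightInverse.choose a') = a at hy ⊢
  generalize (proj_surjective.hasRightInverse.choose b') = b at hy ⊢
  set La := isLocalHomeomorph_proj.localInverseAt a with hLa
  set Lb := isLocalHomeomorph_proj.localInverseAt b with hLb
  set ca := chartAt (ModelProd (EuclideanHalfSpace 1) (EuclideanSpace ℝ (Fin 1))) a
  set cb := chartAt (ModelProd (EuclideanHalfSpace 1) (EuclideanSpace ℝ (Fin 1))) b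
  have hLas : ∀ p, La.symm p = proj p := fun p => by
    rw [hLa, isLocalHomeomorph_proj.localInverseAt_symm]
  have hLbs : ∀ p, Lb.symm p = proj p := fun p => by
    rw [hLb, isLocalHomeomorph_proj.localInverseAt_symm]
  set p := ca.symm (cylModel.symm y) with hp
  have hy1 : cylModel.symm y ∈ ca.target := by
    simp at hy
    exact hy.1.1
  have hy2 : proj p ∈ Lb.source := by
    simp [hLas] at hy
    exact hy.2.1
  have hy3 : Lb (proj p) ∈ cb.source := by
    simp [hLas] at hy
    exact hy.2.2
  obtain ⟨g, hg, hgp, hgq⟩ : ∃ g : Cylinder → Cylinder, ContMDiff cylModel cylModel n g ∧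
      (∀ p', proj (g p') = proj p') ∧ Lb (proj p) = g p := by
    have h : proj p = proj (Lb (proj p)) := ((hLbs _).symm.trans (Lb.left_inv hy2)).symm
    rcases proj_eq_iff.mp h with h | h
    · exact ⟨id, contMDiff_id, fun _ => rfl, h⟩
    · exact ⟨cylInvol, contMDiff_cylInvol,
        fun p' => proj_eq_iff.mpr (Or.inr (cylInvol_cylInvol p').symm), h⟩
  have hev : ∀ᶠ p' in nhds p, Lb (proj p') = g p' := by
    have ht : Lb.target ∈ nhds (g p) := by
      rw [← hgq]
      exact Lb.open_target.mem_nhds (Lb.map_source hy2)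
    filter_upwards [hg.continuous.continuousAt ht] with p' hp'
    rw [← hgp p', ← hLbs, Lb.right_inv hp']
  have hyi : y ∈ cylModel '' ca.target := ⟨_, hy1, cylModel.right_inv hyr⟩
  have hA : ContMDiffWithinAt 𝓘(ℝ, EuclideanSpace ℝ (Fin 1) × EuclideanSpace ℝ (Fin 1)) cylModel n (ca.symm ∘ cylModel.symm)
      (cylModel '' ca.target) y :=
    contMDiffOn_extend_symm (I := cylModel) (n := n) (e := ca)
      (IsManifold.chart_mem_maximalAtlas a) y hyi
  have hB : ContMDiffAt cylModel 𝓘(ℝ, EuclideanSpace ℝ (Fin 1) × EuclideanSpace ℝ (Fin 1)) n (cb.extend cylModel) (g p) := by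
    have := cb.contMDiffOn_extend (I := cylModel) (n := n) (IsManifold.chart_mem_maximalAtlas b)
    exact this.contMDiffAt (cb.open_source.mem_nhds (hgq ▸ hy3))
  have hC : ContMDiffWithinAt 𝓘(ℝ, EuclideanSpace ℝ (Fin 1) × EuclideanSpace ℝ (Fin 1)) 𝓘(ℝ, EuclideanSpace ℝ (Fin 1) × EuclideanSpace ℝ (Fin 1)) n
      (cb.extend cylModel ∘ g ∘ ca.symm ∘ cylModel.symm) (cylModel '' ca.target) y :=
    ContMDiffAt.comp_contMDiffWithinAt (g := cb.extend cylModel ∘ g) y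
      (hB.comp p hg.contMDiffAt) hA
  have hD := contMDiffWithinAt_iff_contDiffWithinAt.mp hC
  refine (hD.congr_of_eventuallyEq ?_ ?_).mono ?_
  · filter_upwards [hA.continuousWithinAt hev] with y' hy'
    simp only [Set.mem_preimage, Set.mem_ofPred_eq, Function.comp] at hy'
    change cylModel (cb (Lb (La.symm (ca.symm (cylModel.symm y'))))) =
      cylModel (cb (g (ca.symm (cylModel.symm y'))))
    rw [hLas, hy']
  · change cylModel (cb (Lb (La.symm p))) = cylModel (cb (g p))
    rw [hLas, hgq]
  · rintro z ⟨hz, hzr⟩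
    refine ⟨_, ?_, cylModel.right_inv hzr⟩
    simp at hz
    exact hz.1.1

end Mobius

end

/-! Both surfaces are quotients of the strip `[0,1] × ℝ` by translations, together with glide
reflections for the Möbius band. The action lifts to a `C^1` flow `Φ` on the strip that commutes
with these deck transformations. Its time-`2π` map lifts the identity and preserves each boundary
line, so it is the translation by `2πj` for an integer `j`.

The flow is straightened by two averages over an orbit. The mean `θ` of the second coordinate
satisfies `θ(Φ_r x) = θ(x) + j r`. The area `A = (2π)⁻¹ ∫ Φ₁ dΦ₂` under the orbit is invariant under
the flow. The velocity `V` is only continuous, so the integrand of `A` cannot be differentiated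
directly, but an integration by parts over a period (`integral_area_sub`) removes the derivative of
`V` and gives `dA(w) = (2π)⁻¹ ∫ det(DΦ_s w, V(Φ_s x)) ds`. The flow carries `V` to itself, so the
integrand is `det(DΦ_s) · det(w, V)` and `dA` is a positive multiple of `det(·, V)`. The kernel of
`dA` is therefore spanned by `V`, on which `dθ = j ≠ 0`, and `F = (A/j, θ/j)` has invertible
derivatives.

On the boundary `A = j t`, so `F` preserves the first coordinate there. A maximum principle keeps
`F` in the strip, an extremal argument on pairs with the same image makes it injective, and the flow
makes it surjective. Thus `F` is a `C^1` diffeomorphism of the strip that turns `Φ` into vertical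
translation (`stripImmersion`, `injOn`, `exists_contDiffOn_inverse`). Faithfulness forces `j = ±1`,
whence `F` and its inverse respect the fibres and descend to the surface (`exists_conjugacy`). -/

/-! ### The strip and continuity in parameters -/

/-- The closed strip `[0,1] × ℝ`, the universal cover of the cylinder and of the Möbius band. -/
def strip : Set (ℝ × ℝ) := Set.Icc 0 1 ×ˢ Set.univ

theorem mem_strip {x : ℝ × ℝ} : x ∈ strip ↔ 0 ≤ x.1 ∧ x.1 ≤ 1 := by simp [strip]

theorem convex_strip : Convex ℝ strip := (convex_Icc 0 1).prod convex_univ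

theorem uniqueDiffOn_strip : UniqueDiffOn ℝ strip :=
  (uniqueDiffOn_Icc one_pos).prod uniqueDiffOn_univ

theorem uniqueDiffOn_univ_prod_strip : UniqueDiffOn ℝ ((Set.univ : Set ℝ) ×ˢ strip) :=
  uniqueDiffOn_univ.prod uniqueDiffOn_strip

theorem strip_mem_nhds {x : ℝ × ℝ} (h0 : 0 < x.1) (h1 : x.1 < 1) : strip ∈ nhds x :=
  prod_mem_nhds (Icc_mem_nhds h0 h1) Filter.univ_mem

/-- The retraction of the plane onto the strip. -/
noncomputable def clampStrip (x : ℝ × ℝ) : ℝ × ℝ := (Set.projIcc (0 : ℝ) 1 zero_le_one x.1, x.2)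

theorem continuous_clampStrip : Continuous clampStrip := by
  unfold clampStrip
  exact (continuous_subtype_val.comp (continuous_projIcc.comp continuous_fst)).prodMk continuous_snd

theorem clampStrip_mem (x : ℝ × ℝ) : clampStrip x ∈ strip :=
  ⟨(Set.projIcc (0 : ℝ) 1 zero_le_one x.1).2, trivial⟩

theorem clampStrip_of_mem {x : ℝ × ℝ} (hx : x ∈ strip) : clampStrip x = x := by
  simp [clampStrip, Set.projIcc_of_mem zero_le_one hx.1]

section Parametric

variable {E : Type*} [NormedAddCommGroup E] {h : ℝ × (ℝ × ℝ) → E}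

theorem ContinuousOn.continuous_clampStrip (hh : ContinuousOn h (Set.univ ×ˢ strip)) :
    Continuous fun p : ℝ × (ℝ × ℝ) => h (p.1, clampStrip p.2) :=
  hh.comp_continuous (continuous_fst.prodMk (_root_.continuous_clampStrip.comp continuous_snd))
    fun p => ⟨trivial, clampStrip_mem p.2⟩

theorem ContinuousOn.continuous_left_of_strip (hh : ContinuousOn h (Set.univ ×ˢ strip))
    {x : ℝ × ℝ} (hx : x ∈ strip) : Continuous fun s => h (s, x) :=
  hh.comp_continuous (continuous_id.prodMk continuous_const) fun _ => ⟨trivial, hx⟩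

theorem ContinuousOn.intervalIntegral_strip [NormedSpace ℝ E]
    (hh : ContinuousOn h (Set.univ ×ˢ strip)) (a b : ℝ) :
    ContinuousOn (fun x => ∫ s in a..b, h (s, x)) strip := by
  have h1 : Continuous fun x => ∫ s in a..b, h (s, clampStrip x) :=
    intervalIntegral.continuous_parametric_intervalIntegral_of_continuous'
      (f := fun x s => h (s, clampStrip x)) (hh.continuous_clampStrip.comp continuous_swap) a b
  exact h1.continuousOn.congr fun x hx => by simp [clampStrip_of_mem hx]

/-- Tube lemma: the time interval is compact, so continuity at `x` is uniform in `s`. Composing with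
`clampStrip` makes the function continuous on the whole plane. -/
theorem ContinuousOn.eventually_norm_sub_le_strip
    (hh : ContinuousOn h (Set.univ ×ˢ strip)) (a b : ℝ) {x : ℝ × ℝ} (hx : x ∈ strip) {ε : ℝ}
    (hε : 0 < ε) :
    ∀ᶠ y in nhds x, y ∈ strip → ∀ s ∈ Set.Icc a b, ‖h (s, y) - h (s, x)‖ ≤ ε := by
  have hc := hh.continuous_clampStrip
  have key : ∀ᶠ y in nhds x, ∀ s ∈ Set.Icc a b,
      ‖h (s, clampStrip y) - h (s, clampStrip x)‖ < ε := by
    apply isCompact_Icc.eventually_forall_of_forall_eventually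
    intro s _
    have h2 : Continuous fun z : (ℝ × ℝ) × ℝ =>
        ‖h (z.2, clampStrip z.1) - h (z.2, clampStrip x)‖ :=
      ((hc.comp continuous_swap).sub
        (hc.comp (continuous_snd.prodMk continuous_const))).norm
    apply (h2.tendsto (x, s)).eventually_lt_const
    simpa using hε
  filter_upwards [key] with y hy hys s hs
  have := hy s hs
  rw [clampStrip_of_mem hx, clampStrip_of_mem hys] at this
  exact this.le

end Parametric

/-! ### Flows of class `C^1` on the strip -/

/-- The derivative of `Φ (s, ·)` at a point of the strip. -/
noncomputable def flowDeriv (Φ : ℝ × (ℝ × ℝ) → ℝ × ℝ) (p : ℝ × (ℝ × ℝ)) : ℝ × ℝ →L[ℝ] ℝ × ℝ :=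
  (fderivWithin ℝ Φ (Set.univ ×ˢ strip) p).comp (ContinuousLinearMap.inr ℝ ℝ (ℝ × ℝ))

/-- The velocity of the curve `s ↦ Φ (s, x)`. -/
noncomputable def flowVel (Φ : ℝ × (ℝ × ℝ) → ℝ × ℝ) (p : ℝ × (ℝ × ℝ)) : ℝ × ℝ :=
  fderivWithin ℝ Φ (Set.univ ×ˢ strip) p (1, 0)

/-- A flow of class `C^1` on the strip. -/
structure StripFlow (Φ : ℝ × (ℝ × ℝ) → ℝ × ℝ) : Prop where
  contDiffOn : ContDiffOn ℝ 1 Φ (Set.univ ×ˢ strip)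
  mem : ∀ s, ∀ x ∈ strip, Φ (s, x) ∈ strip
  zero : ∀ x ∈ strip, Φ (0, x) = x
  add : ∀ a b, ∀ x ∈ strip, Φ (a, Φ (b, x)) = Φ (a + b, x)

namespace StripFlow

variable {Φ : ℝ × (ℝ × ℝ) → ℝ × ℝ}

theorem continuousOn_fderivWithin (hΦ : StripFlow Φ) :
    ContinuousOn (fderivWithin ℝ Φ (Set.univ ×ˢ strip)) (Set.univ ×ˢ strip) :=
  hΦ.contDiffOn.continuousOn_fderivWithin uniqueDiffOn_univ_prod_strip le_rfl

theorem continuousOn_flowDeriv (hΦ : StripFlow Φ) :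
    ContinuousOn (flowDeriv Φ) (Set.univ ×ˢ strip) :=
  hΦ.continuousOn_fderivWithin.clm_comp continuousOn_const

theorem continuousOn_flowVel (hΦ : StripFlow Φ) : ContinuousOn (flowVel Φ) (Set.univ ×ˢ strip) :=
  hΦ.continuousOn_fderivWithin.clm_apply continuousOn_const

theorem hasFDerivWithinAt (hΦ : StripFlow Φ) (s : ℝ) {x : ℝ × ℝ} (hx : x ∈ strip) :
    HasFDerivWithinAt Φ (fderivWithin ℝ Φ (Set.univ ×ˢ strip) (s, x)) (Set.univ ×ˢ strip) (s, x) :=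
  ((hΦ.contDiffOn.differentiableOn one_ne_zero) _ ⟨trivial, hx⟩).hasFDerivWithinAt

theorem hasFDerivWithinAt_space (hΦ : StripFlow Φ) (s : ℝ) {x : ℝ × ℝ} (hx : x ∈ strip) :
    HasFDerivWithinAt (fun y => Φ (s, y)) (flowDeriv Φ (s, x)) strip x :=
  (hΦ.hasFDerivWithinAt s hx).comp x (hasFDerivAt_prodMk_right s x).hasFDerivWithinAt
    fun _ hy => ⟨trivial, hy⟩

theorem hasDerivAt_time (hΦ : StripFlow Φ) (s : ℝ) {x : ℝ × ℝ} (hx : x ∈ strip) :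
    HasDerivAt (fun r => Φ (r, x)) (flowVel Φ (s, x)) s := by
  have h1 : HasDerivWithinAt (fun r : ℝ => (r, x)) (1, 0) Set.univ s :=
    ((hasDerivAt_id s).prodMk (hasDerivAt_const s x)).hasDerivWithinAt
  have h := (hΦ.hasFDerivWithinAt s hx).comp_hasDerivWithinAt s h1
    (show Set.MapsTo _ _ (Set.univ ×ˢ strip) from fun _ _ => ⟨trivial, hx⟩)
  exact hasDerivWithinAt_univ.mp h

theorem hasDerivAt_time_fst (hΦ : StripFlow Φ) (s : ℝ) {x : ℝ × ℝ} (hx : x ∈ strip) :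
    HasDerivAt (fun r => (Φ (r, x)).1) (flowVel Φ (s, x)).1 s :=
  (hasFDerivAt_fst (𝕜 := ℝ) (E := ℝ) (F := ℝ)).comp_hasDerivAt s (hΦ.hasDerivAt_time s hx)

theorem hasDerivAt_time_snd (hΦ : StripFlow Φ) (s : ℝ) {x : ℝ × ℝ} (hx : x ∈ strip) :
    HasDerivAt (fun r => (Φ (r, x)).2) (flowVel Φ (s, x)).2 s :=
  (hasFDerivAt_snd (𝕜 := ℝ) (E := ℝ) (F := ℝ)).comp_hasDerivAt s (hΦ.hasDerivAt_time s hx)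

theorem flowVel_apply_flow (hΦ : StripFlow Φ) (s r : ℝ) {x : ℝ × ℝ} (hx : x ∈ strip) :
    flowVel Φ (s, Φ (r, x)) = flowVel Φ (s + r, x) := by
  have h1 := hΦ.hasDerivAt_time s (hΦ.mem r x hx)
  have h2 := (hΦ.hasDerivAt_time (s + r) hx).comp_add_const s r
  refine h1.unique (h2.congr_of_eventuallyEq (Filter.Eventually.of_forall fun a => ?_))
  exact hΦ.add a r x hx

/-- The flow carries its velocity field to itself: differentiate `Φ (s, Φ (a, x)) = Φ (s + a, x)` in
`a` at `0`. -/
theorem flowDeriv_flowVel (hΦ : StripFlow Φ) (s : ℝ) {x : ℝ × ℝ} (hx : x ∈ strip) :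
    flowDeriv Φ (s, x) (flowVel Φ (0, x)) = flowVel Φ (s, x) := by
  have h0 : Φ (0, x) = x := hΦ.zero x hx
  have h1 := hΦ.hasFDerivWithinAt_space s hx
  rw [← h0] at h1
  have h2 := h1.comp_hasDerivWithinAt (s := Set.univ) (0 : ℝ)
    (hΦ.hasDerivAt_time 0 hx).hasDerivWithinAt fun r _ => hΦ.mem r x hx
  rw [hasDerivWithinAt_univ] at h2
  have h3 := (hΦ.hasDerivAt_time (s + 0) hx).comp_const_add s 0
  rw [h0] at h2
  rw [add_zero] at h3
  refine h2.unique (h3.congr_of_eventuallyEq (Filter.Eventually.of_forall fun a => ?_))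
  exact hΦ.add s a x hx

theorem flowDeriv_neg_comp (hΦ : StripFlow Φ) (s : ℝ) {x : ℝ × ℝ} (hx : x ∈ strip) :
    (flowDeriv Φ (-s, Φ (s, x))).comp (flowDeriv Φ (s, x)) = ContinuousLinearMap.id ℝ (ℝ × ℝ) := by
  have h := (hΦ.hasFDerivWithinAt_space (-s) (hΦ.mem s x hx)).comp x
    (hΦ.hasFDerivWithinAt_space s hx) (hΦ.mem s)
  refine (uniqueDiffOn_strip x hx).eq h ((hasFDerivWithinAt_id x strip).congr (fun y hy => ?_) ?_)
  · simp [hΦ.add _ _ y hy, hΦ.zero y hy]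
  · simp [hΦ.add _ _ x hx, hΦ.zero x hx]

theorem flowDeriv_injective (hΦ : StripFlow Φ) (s : ℝ) {x : ℝ × ℝ} (hx : x ∈ strip) :
    Function.Injective (flowDeriv Φ (s, x)) := by
  apply Function.LeftInverse.injective (g := flowDeriv Φ (-s, Φ (s, x)))
  exact fun w => DFunLike.congr_fun (hΦ.flowDeriv_neg_comp s hx) w

theorem flowDeriv_zero (hΦ : StripFlow Φ) {x : ℝ × ℝ} (hx : x ∈ strip) :
    flowDeriv Φ (0, x) = ContinuousLinearMap.id ℝ (ℝ × ℝ) :=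
  (uniqueDiffOn_strip x hx).eq (hΦ.hasFDerivWithinAt_space 0 hx)
    ((hasFDerivWithinAt_id x strip).congr (fun y hy => hΦ.zero y hy) (hΦ.zero x hx))

/-- The derivative of the flow approximates it uniformly for times in a compact interval. -/
theorem eventually_norm_sub_le (hΦ : StripFlow Φ) (a b : ℝ) {x : ℝ × ℝ} (hx : x ∈ strip)
    {ε : ℝ} (hε : 0 < ε) :
    ∀ᶠ y in nhdsWithin x strip, ∀ s ∈ Set.Icc a b,
      ‖Φ (s, y) - Φ (s, x) - flowDeriv Φ (s, x) (y - x)‖ ≤ ε * ‖y - x‖ := by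
  obtain ⟨δ, hδ, hball⟩ := Metric.eventually_nhds_iff_ball.mp
    (hΦ.continuousOn_flowDeriv.eventually_norm_sub_le_strip a b hx hε)
  filter_upwards [inter_mem_nhdsWithin strip (Metric.ball_mem_nhds x hδ)] with y hy s hs
  exact (convex_strip.inter (convex_ball x δ)).norm_image_sub_le_of_norm_hasFDerivWithin_le'
    (f := fun y => Φ (s, y))
    (fun z hz => (hΦ.hasFDerivWithinAt_space s hz.1).mono Set.inter_subset_left)
    (fun z hz => hball z hz.2 hz.1 s hs) ⟨hx, Metric.mem_ball_self hδ⟩ hy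

end StripFlow

/-! ### Determinants in the plane -/

/-- The determinant of two vectors of the plane. -/
def planeDet (v w : ℝ × ℝ) : ℝ := v.1 * w.2 - v.2 * w.1

/-- The determinant of an endomorphism of the plane. -/
def planeJac (L : ℝ × ℝ →L[ℝ] ℝ × ℝ) : ℝ := planeDet (L (1, 0)) (L (0, 1))

theorem planeDet_map (L : ℝ × ℝ →L[ℝ] ℝ × ℝ) (v w : ℝ × ℝ) :
    planeDet (L v) (L w) = planeJac L * planeDet v w := by
  have h : ∀ u : ℝ × ℝ, L u = u.1 • L (1, 0) + u.2 • L (0, 1) := fun u => by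
    rw [← map_smul, ← map_smul, ← map_add]
    simp
  rw [h v, h w]
  simp only [planeJac, planeDet, Prod.fst_add, Prod.snd_add, Prod.smul_fst, Prod.smul_snd,
    smul_eq_mul]
  ring

theorem planeJac_id : planeJac (ContinuousLinearMap.id ℝ (ℝ × ℝ)) = 1 := by
  simp [planeJac, planeDet]

theorem planeJac_comp (L M : ℝ × ℝ →L[ℝ] ℝ × ℝ) :
    planeJac (L.comp M) = planeJac L * planeJac M := by
  change planeDet (L (M (1, 0))) (L (M (0, 1))) = _
  rw [planeDet_map]
  rfl

theorem Continuous.planeDet {X : Type*} [TopologicalSpace X] {a b : X → ℝ × ℝ}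
    (ha : Continuous a) (hb : Continuous b) : Continuous fun s => planeDet (a s) (b s) :=
  (ha.fst.mul hb.snd).sub (ha.snd.mul hb.fst)

theorem exists_smul_of_planeDet_eq_zero {v w : ℝ × ℝ} (hv : v ≠ 0) (h : planeDet w v = 0) :
    ∃ c : ℝ, w = c • v := by
  simp only [planeDet] at h
  by_cases h1 : v.1 = 0
  · have h2 : v.2 ≠ 0 := fun h2 => hv (Prod.ext h1 h2)
    refine ⟨w.2 / v.2, Prod.ext ?_ ?_⟩
    · have : w.1 * v.2 = 0 := by rw [h1] at h; linarith
      simp [h1, (mul_eq_zero.mp this).resolve_right h2]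
    · simp [h2]
  · refine ⟨w.1 / v.1, Prod.ext ?_ ?_⟩
    · simp [h1]
    · simp only [Prod.smul_snd, smul_eq_mul]
      field_simp
      linarith

/-! ### Mean angle and area of an orbit, and their derivatives -/

/-- The mean of the second coordinate over an orbit. -/
noncomputable def orbitAngle (Φ : ℝ × (ℝ × ℝ) → ℝ × ℝ) (x : ℝ × ℝ) : ℝ :=
  (2 * Real.pi)⁻¹ * ∫ s in (0)..(2 * Real.pi), (Φ (s, x)).2

/-- The area under an orbit. -/
noncomputable def orbitArea (Φ : ℝ × (ℝ × ℝ) → ℝ × ℝ) (x : ℝ × ℝ) : ℝ :=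
  (2 * Real.pi)⁻¹ * ∫ s in (0)..(2 * Real.pi), (Φ (s, x)).1 * (flowVel Φ (s, x)).2

/-- The derivative of `orbitAngle`. -/
noncomputable def orbitAngleDeriv (Φ : ℝ × (ℝ × ℝ) → ℝ × ℝ) (x : ℝ × ℝ) : ℝ × ℝ →L[ℝ] ℝ :=
  (2 * Real.pi)⁻¹ • ∫ s in (0)..(2 * Real.pi),
    (ContinuousLinearMap.snd ℝ ℝ ℝ).comp (flowDeriv Φ (s, x))

/-- The linear form `w ↦ det (L w, v)`. -/
def planeDetForm (L : ℝ × ℝ →L[ℝ] ℝ × ℝ) (v : ℝ × ℝ) : ℝ × ℝ →L[ℝ] ℝ :=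
  v.2 • (ContinuousLinearMap.fst ℝ ℝ ℝ).comp L - v.1 • (ContinuousLinearMap.snd ℝ ℝ ℝ).comp L

theorem planeDetForm_apply (L : ℝ × ℝ →L[ℝ] ℝ × ℝ) (v w : ℝ × ℝ) :
    planeDetForm L v w = planeDet (L w) v := by
  simp [planeDetForm, planeDet, mul_comm]

/-- The derivative of `orbitArea`. -/
noncomputable def orbitAreaDeriv (Φ : ℝ × (ℝ × ℝ) → ℝ × ℝ) (x : ℝ × ℝ) : ℝ × ℝ →L[ℝ] ℝ :=
  (2 * Real.pi)⁻¹ • ∫ s in (0)..(2 * Real.pi), planeDetForm (flowDeriv Φ (s, x)) (flowVel Φ (s, x))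

namespace StripFlow

variable {Φ : ℝ × (ℝ × ℝ) → ℝ × ℝ}

theorem continuousOn_planeDetForm (hΦ : StripFlow Φ) :
    ContinuousOn (fun p => planeDetForm (flowDeriv Φ p) (flowVel Φ p)) (Set.univ ×ˢ strip) := by
  have h1 := hΦ.continuousOn_flowDeriv
  have h2 := hΦ.continuousOn_flowVel
  exact (h2.snd.smul (continuousOn_const.clm_comp h1)).sub
    (h2.fst.smul (continuousOn_const.clm_comp h1))

theorem continuousOn_orbitAngleDeriv (hΦ : StripFlow Φ) :
    ContinuousOn (orbitAngleDeriv Φ) strip := by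
  have h : ContinuousOn (fun p => (ContinuousLinearMap.snd ℝ ℝ ℝ).comp (flowDeriv Φ p))
      (Set.univ ×ˢ strip) := continuousOn_const.clm_comp hΦ.continuousOn_flowDeriv
  exact (continuousOn_const (c := (2 * Real.pi)⁻¹)).smul (h.intervalIntegral_strip 0 (2 * Real.pi))

theorem continuousOn_orbitAreaDeriv (hΦ : StripFlow Φ) :
    ContinuousOn (orbitAreaDeriv Φ) strip :=
  (continuousOn_const (c := (2 * Real.pi)⁻¹)).smul
    (hΦ.continuousOn_planeDetForm.intervalIntegral_strip 0 (2 * Real.pi))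

theorem hasFDerivWithinAt_orbitAngle (hΦ : StripFlow Φ) {x : ℝ × ℝ} (hx : x ∈ strip) :
    HasFDerivWithinAt (orbitAngle Φ) (orbitAngleDeriv Φ x) strip x := by
  suffices h : HasFDerivWithinAt (fun x => ∫ s in (0)..(2 * Real.pi), (Φ (s, x)).2)
      (∫ s in (0)..(2 * Real.pi), (ContinuousLinearMap.snd ℝ ℝ ℝ).comp (flowDeriv Φ (s, x)))
      strip x from h.const_mul _
  refine .of_isLittleO ?_
  rw [Asymptotics.isLittleO_iff]
  intro ε hε
  have hpi := Real.two_pi_pos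
  filter_upwards [hΦ.eventually_norm_sub_le 0 (2 * Real.pi) hx (div_pos hε hpi),
    self_mem_nhdsWithin] with y hy hys
  have hc : ∀ z ∈ strip, Continuous fun s => (Φ (s, z)).2 := fun z hz =>
    (hΦ.contDiffOn.continuousOn.continuous_left_of_strip hz).snd
  have hL : Continuous fun s => (ContinuousLinearMap.snd ℝ ℝ ℝ).comp (flowDeriv Φ (s, x)) :=
    continuous_const.clm_comp (hΦ.continuousOn_flowDeriv.continuous_left_of_strip hx)
  rw [ContinuousLinearMap.intervalIntegral_apply (hL.intervalIntegrable _ _),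
    ← intervalIntegral.integral_sub ((hc y hys).intervalIntegrable _ _)
      ((hc x hx).intervalIntegrable _ _),
    ← intervalIntegral.integral_sub]
  rotate_left
  · exact ((hc y hys).sub (hc x hx)).intervalIntegrable _ _
  · exact (hL.clm_apply continuous_const).intervalIntegrable _ _
  refine (intervalIntegral.norm_integral_le_of_norm_le_const (C := ε / (2 * Real.pi) * ‖y - x‖)
    fun s hs => ?_).trans ?_
  · rw [Set.uIoc_of_le hpi.le] at hs
    exact (norm_snd_le _).trans (hy s ⟨hs.1.le, hs.2⟩)
  · rw [sub_zero, abs_of_pos hpi]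
    field_simp
    rfl

/-- The area formula for two neighbouring orbits: integration by parts. -/
theorem integral_area_sub (hΦ : StripFlow Φ) {j : ℝ}
    (hj : ∀ x ∈ strip, Φ (2 * Real.pi, x) = (x.1, x.2 + 2 * Real.pi * j))
    {x y : ℝ × ℝ} (hx : x ∈ strip) (hy : y ∈ strip) :
    (∫ s in (0)..(2 * Real.pi), (Φ (s, y)).1 * (flowVel Φ (s, y)).2) -
      (∫ s in (0)..(2 * Real.pi), (Φ (s, x)).1 * (flowVel Φ (s, x)).2) =
    ∫ s in (0)..(2 * Real.pi), (planeDet (Φ (s, y) - Φ (s, x)) (flowVel Φ (s, x)) +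
      ((Φ (s, y)).1 - (Φ (s, x)).1) * ((flowVel Φ (s, y)).2 - (flowVel Φ (s, x)).2)) := by
  have hc : ∀ z ∈ strip, Continuous fun s => Φ (s, z) := fun z hz =>
    hΦ.contDiffOn.continuousOn.continuous_left_of_strip hz
  have hv : ∀ z ∈ strip, Continuous fun s => flowVel Φ (s, z) := fun z hz =>
    hΦ.continuousOn_flowVel.continuous_left_of_strip hz
  have hcx := hc x hx
  have hcy := hc y hy
  have hvx := hv x hx
  have hvy := hv y hy
  -- The two integrands of the statement differ by the derivative of `Φ₁(s,x) (Φ₂(s,y) - Φ₂(s,x))`.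
  -- This product takes the same value at `0` and `2π`, because both second coordinates grow by
  -- `2πj`.
  have hparts := intervalIntegral.integral_deriv_mul_eq_sub (a := 0) (b := 2 * Real.pi)
    (fun s _ => hΦ.hasDerivAt_time_fst s hx)
    (fun s _ => (hΦ.hasDerivAt_time_snd s hy).sub (hΦ.hasDerivAt_time_snd s hx))
    (hvx.fst.intervalIntegrable _ _) ((hvy.snd.sub hvx.snd).intervalIntegrable _ _)
  simp only [Pi.sub_apply, hj x hx, hj y hy, hΦ.zero x hx, hΦ.zero y hy] at hparts
  have h1 : Continuous fun s => (Φ (s, y)).1 * (flowVel Φ (s, y)).2 := hcy.fst.mul hvy.snd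
  have h2 : Continuous fun s => (Φ (s, x)).1 * (flowVel Φ (s, x)).2 := hcx.fst.mul hvx.snd
  rw [← intervalIntegral.integral_sub (h1.intervalIntegrable _ _) (h2.intervalIntegrable _ _),
    ← sub_eq_zero, ← intervalIntegral.integral_sub]
  · refine (intervalIntegral.integral_congr fun s _ => ?_).trans
      (hparts.trans (by ring))
    simp only [planeDet, Prod.fst_sub, Prod.snd_sub]
    ring
  · exact (h1.sub h2).intervalIntegrable _ _
  · exact (((hcy.sub hcx).planeDet hvx).add
      ((hcy.fst.sub hcx.fst).mul (hvy.snd.sub hvx.snd))).intervalIntegrable _ _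

/-- The velocity is only continuous, so differentiation under the integral sign is not available. In
`integral_area_sub` the velocity at `y` occurs only in a product of two small factors, so the
first-order term involves only the velocity at `x`. -/
theorem hasFDerivWithinAt_orbitArea (hΦ : StripFlow Φ) {j : ℝ}
    (hj : ∀ x ∈ strip, Φ (2 * Real.pi, x) = (x.1, x.2 + 2 * Real.pi * j))
    {x : ℝ × ℝ} (hx : x ∈ strip) :
    HasFDerivWithinAt (orbitArea Φ) (orbitAreaDeriv Φ x) strip x := by
  suffices h : HasFDerivWithinAt
      (fun x => ∫ s in (0)..(2 * Real.pi), (Φ (s, x)).1 * (flowVel Φ (s, x)).2)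
      (∫ s in (0)..(2 * Real.pi), planeDetForm (flowDeriv Φ (s, x)) (flowVel Φ (s, x)))
      strip x from h.const_mul _
  refine .of_isLittleO ?_
  rw [Asymptotics.isLittleO_iff]
  intro ε hε
  have hpi := Real.two_pi_pos
  have hcx : Continuous fun s => Φ (s, x) := hΦ.contDiffOn.continuousOn.continuous_left_of_strip hx
  have hvx : Continuous fun s => flowVel Φ (s, x) :=
    hΦ.continuousOn_flowVel.continuous_left_of_strip hx
  have hLx : Continuous fun s => flowDeriv Φ (s, x) :=
    hΦ.continuousOn_flowDeriv.continuous_left_of_strip hx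
  obtain ⟨M, hM⟩ := isCompact_Icc.exists_bound_of_continuousOn
    (s := Set.Icc 0 (2 * Real.pi)) hvx.continuousOn
  obtain ⟨K, hK⟩ := isCompact_Icc.exists_bound_of_continuousOn
    (s := Set.Icc 0 (2 * Real.pi)) hLx.continuousOn
  have hM0 : 0 ≤ M := (norm_nonneg _).trans (hM 0 ⟨le_rfl, hpi.le⟩)
  have hK0 : 0 ≤ K := (norm_nonneg _).trans (hK 0 ⟨le_rfl, hpi.le⟩)
  -- With `η` bounding both the linearization error of the flow, relative to `‖y - x‖`, and the
  -- variation of the velocity, the determinant contributes `2ηM` and the product term `η(K + 1)`.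
  -- The condition `η ≤ 1` serves to bound the displacement by `(K + 1)‖y - x‖`.
  set C := 2 * M + K + 1 with hC
  have hCpos : 0 < C := by positivity
  set η := min 1 (ε / (C * (2 * Real.pi))) with hη
  have hη0 : 0 < η := lt_min one_pos (by positivity)
  have hη1 : η ≤ 1 := min_le_left _ _
  have hη2 : η * C * (2 * Real.pi) ≤ ε := by
    have := min_le_right 1 (ε / (C * (2 * Real.pi)))
    rw [← hη, le_div_iff₀ (by positivity)] at this
    linarith
  filter_upwards [hΦ.eventually_norm_sub_le 0 (2 * Real.pi) hx hη0,
    (hΦ.continuousOn_flowVel.eventually_norm_sub_le_strip 0 (2 * Real.pi) hx hη0).filter_mono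
      nhdsWithin_le_nhds,
    self_mem_nhdsWithin] with y hy hyv hys
  have hcy : Continuous fun s => Φ (s, y) := hΦ.contDiffOn.continuousOn.continuous_left_of_strip hys
  have hvy : Continuous fun s => flowVel Φ (s, y) :=
    hΦ.continuousOn_flowVel.continuous_left_of_strip hys
  have hF : Continuous fun s => planeDetForm (flowDeriv Φ (s, x)) (flowVel Φ (s, x)) :=
    hΦ.continuousOn_planeDetForm.continuous_left_of_strip hx
  rw [ContinuousLinearMap.intervalIntegral_apply (hF.intervalIntegrable _ _),
    hΦ.integral_area_sub hj hx hys, ← intervalIntegral.integral_sub]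
  rotate_left
  · exact (((hcy.sub hcx).planeDet hvx).add
      ((hcy.fst.sub hcx.fst).mul (hvy.snd.sub hvx.snd))).intervalIntegrable _ _
  · exact (hF.clm_apply continuous_const).intervalIntegrable _ _
  refine (intervalIntegral.norm_integral_le_of_norm_le_const (C := η * C * ‖y - x‖)
    fun s hs => ?_).trans ?_
  · rw [Set.uIoc_of_le hpi.le] at hs
    have hs' : s ∈ Set.Icc 0 (2 * Real.pi) := ⟨hs.1.le, hs.2⟩
    set w := y - x
    set v := flowVel Φ (s, x)
    set d := Φ (s, y) - Φ (s, x) with hd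
    set u := flowVel Φ (s, y) - v with hu
    set L := flowDeriv Φ (s, x)
    have e1 : planeDet d v + ((Φ (s, y)).1 - (Φ (s, x)).1) * ((flowVel Φ (s, y)).2 - v.2) -
        planeDetForm L v w = planeDet (d - L w) v + d.1 * u.2 := by
      rw [planeDetForm_apply]
      simp only [planeDet, hd, hu, Prod.fst_sub, Prod.snd_sub]
      ring
    have hr : ‖d - L w‖ ≤ η * ‖w‖ := hy s hs'
    have hu' : ‖u‖ ≤ η := hyv hys s hs'
    have hd' : ‖d‖ ≤ (K + 1) * ‖w‖ := by
      have h1 : ‖L w‖ ≤ K * ‖w‖ := (L.le_opNorm w).trans (by gcongr; exact hK s hs')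
      have h2 : ‖d‖ ≤ ‖d - L w‖ + ‖L w‖ := by simpa using norm_add_le (d - L w) (L w)
      have h3 : η * ‖w‖ ≤ 1 * ‖w‖ := by gcongr
      linarith
    have hdet : ‖planeDet (d - L w) v‖ ≤ η * ‖w‖ * M + η * ‖w‖ * M := by
      refine (norm_sub_le _ _).trans ?_
      rw [norm_mul, norm_mul]
      gcongr
      · exact (norm_fst_le _).trans hr
      · exact (norm_snd_le _).trans (hM s hs')
      · exact (norm_snd_le _).trans hr
      · exact (norm_fst_le _).trans (hM s hs')
    have hdu : ‖d.1 * u.2‖ ≤ (K + 1) * ‖w‖ * η := by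
      rw [norm_mul]
      gcongr
      · exact (norm_fst_le _).trans hd'
      · exact (norm_snd_le _).trans hu'
    rw [e1]
    refine (norm_add_le _ _).trans ((add_le_add hdet hdu).trans (le_of_eq ?_))
    rw [hC]
    ring
  · rw [sub_zero, abs_of_pos hpi]
    calc η * C * ‖y - x‖ * (2 * Real.pi) = η * C * (2 * Real.pi) * ‖y - x‖ := by ring
      _ ≤ ε * ‖y - x‖ := by gcongr

end StripFlow

/-! ### Boundary behaviour and orientation of the flow -/

namespace StripFlow

variable {Φ : ℝ × (ℝ × ℝ) → ℝ × ℝ}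

theorem continuous_time (hΦ : StripFlow Φ) {x : ℝ × ℝ} (hx : x ∈ strip) :
    Continuous fun s => Φ (s, x) :=
  hΦ.contDiffOn.continuousOn.continuous_left_of_strip hx

theorem continuous_flowVel (hΦ : StripFlow Φ) {x : ℝ × ℝ} (hx : x ∈ strip) :
    Continuous fun s => flowVel Φ (s, x) :=
  hΦ.continuousOn_flowVel.continuous_left_of_strip hx

theorem neg_apply (hΦ : StripFlow Φ) (s : ℝ) {x : ℝ × ℝ} (hx : x ∈ strip) :
    Φ (-s, Φ (s, x)) = x := by
  rw [hΦ.add _ _ x hx, neg_add_cancel, hΦ.zero x hx]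

/-- The velocity along the orbit is the image of the initial velocity under the derivative of the
flow, so it stays zero. No uniqueness theorem for differential equations is needed, and none would
apply to a merely continuous field. -/
theorem apply_eq_self_of_flowVel_eq_zero (hΦ : StripFlow Φ) {x : ℝ × ℝ} (hx : x ∈ strip)
    (h : flowVel Φ (0, x) = 0) (s : ℝ) : Φ (s, x) = x := by
  have h1 : ∀ r, HasDerivAt (fun r => Φ (r, x)) 0 r := fun r => by
    have := hΦ.hasDerivAt_time r hx
    rwa [← hΦ.flowDeriv_flowVel r hx, h, map_zero] at this
  have h2 := is_const_of_deriv_eq_zero (fun r => (h1 r).differentiableAt)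
    (fun r => (h1 r).deriv) s 0
  simpa [hΦ.zero x hx] using h2

/-- At an interior point sent to the boundary the first coordinate of the flow would have a local
extremum, against the surjectivity of the derivative. -/
theorem interior_of_interior (hΦ : StripFlow Φ) (s : ℝ) {x : ℝ × ℝ} (h0 : 0 < x.1)
    (h1 : x.1 < 1) : 0 < (Φ (s, x)).1 ∧ (Φ (s, x)).1 < 1 := by
  have hx : x ∈ strip := mem_strip.mpr ⟨h0.le, h1.le⟩
  have hnhds := strip_mem_nhds h0 h1
  have hd : HasFDerivAt (fun y => (Φ (s, y)).1)
      ((ContinuousLinearMap.fst ℝ ℝ ℝ).comp (flowDeriv Φ (s, x))) x :=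
    (ContinuousLinearMap.fst ℝ ℝ ℝ).hasFDerivAt.comp x
      ((hΦ.hasFDerivWithinAt_space s hx).hasFDerivAt hnhds)
  have hne : ¬ IsLocalExtr (fun y => (Φ (s, y)).1) x := by
    intro h
    have hz := h.hasFDerivAt_eq_zero hd
    have hsurj : Function.Surjective (flowDeriv Φ (s, x)) :=
      (LinearMap.injective_iff_surjective (f := (flowDeriv Φ (s, x)).toLinearMap)).mp
        (hΦ.flowDeriv_injective s hx)
    obtain ⟨w, hw⟩ := hsurj (1, 0)
    have := DFunLike.congr_fun hz w
    simp [hw] at this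
  have hmem := mem_strip.mp (hΦ.mem s x hx)
  constructor
  · refine lt_of_le_of_ne hmem.1 fun h => hne (Or.inl ?_)
    filter_upwards [hnhds] with y hy
    rw [← h]
    exact (mem_strip.mp (hΦ.mem s y hy)).1
  · refine lt_of_le_of_ne hmem.2 fun h => hne (Or.inr ?_)
    filter_upwards [hnhds] with y hy
    rw [h]
    exact (mem_strip.mp (hΦ.mem s y hy)).2

/-- The flow preserves each boundary line of the strip. -/
theorem fst_eq_of_boundary (hΦ : StripFlow Φ) (s : ℝ) {x : ℝ × ℝ} (hx : x.1 = 0 ∨ x.1 = 1) :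
    (Φ (s, x)).1 = x.1 := by
  have hxs : x ∈ strip := mem_strip.mpr (by rcases hx with h | h <;> rw [h] <;> norm_num)
  -- If a boundary point entered the interior, flowing back would keep it there. By continuity in
  -- time, the orbit then cannot jump from one line to the other.
  have hb : ∀ r, (Φ (r, x)).1 = 0 ∨ (Φ (r, x)).1 = 1 := by
    intro r
    by_contra! h
    have hm := mem_strip.mp (hΦ.mem r x hxs)
    have := hΦ.interior_of_interior (-r) (lt_of_le_of_ne hm.1 h.1.symm) (lt_of_le_of_ne hm.2 h.2)
    rw [hΦ.neg_apply r hxs] at this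
    rcases hx with h | h <;> rw [h] at this <;> norm_num at this
  have hc : Continuous fun r => (Φ (r, x)).1 := (hΦ.continuous_time hxs).fst
  by_contra hne
  have h0 : (Φ (0, x)).1 = x.1 := by rw [hΦ.zero x hxs]
  have hmid : (1 / 2 : ℝ) ∈ Set.range fun r => (Φ (r, x)).1 := by
    rcases hb s with h | h <;> rcases hx with h' | h' <;> rw [h'] at h0 hne
    · exact absurd h hne
    · exact mem_range_of_exists_le_of_exists_ge hc ⟨s, by simp [h]⟩ ⟨0, by rw [h0]; norm_num⟩
    · exact mem_range_of_exists_le_of_exists_ge hc ⟨0, by simp [h0]⟩ ⟨s, by rw [h]; norm_num⟩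
    · exact absurd h hne
  obtain ⟨r, hr⟩ := hmid
  rcases hb r with h | h <;> simp only [h] at hr <;> norm_num at hr

/-- The Jacobian never vanishes, is `1` at time `0`, and is continuous in time. -/
theorem planeJac_flowDeriv_pos (hΦ : StripFlow Φ) (s : ℝ) {x : ℝ × ℝ} (hx : x ∈ strip) :
    0 < planeJac (flowDeriv Φ (s, x)) := by
  have hne : ∀ r, planeJac (flowDeriv Φ (r, x)) ≠ 0 := by
    intro r h
    have := planeJac_comp (flowDeriv Φ (-r, Φ (r, x))) (flowDeriv Φ (r, x))
    rw [hΦ.flowDeriv_neg_comp r hx, planeJac_id, h, mul_zero] at this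
    exact one_ne_zero this
  have hL : Continuous fun r => flowDeriv Φ (r, x) :=
    hΦ.continuousOn_flowDeriv.continuous_left_of_strip hx
  have hc : Continuous fun r => planeJac (flowDeriv Φ (r, x)) :=
    (hL.clm_apply continuous_const).planeDet (hL.clm_apply continuous_const)
  by_contra! hneg
  obtain ⟨r, hr⟩ := mem_range_of_exists_le_of_exists_ge hc ⟨s, hneg⟩
    ⟨0, by rw [hΦ.flowDeriv_zero hx, planeJac_id]; exact zero_le_one⟩
  exact hne r hr

/-- The derivative of `orbitArea` is a positive multiple of the contraction of the area form
with the velocity. -/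
theorem exists_orbitAreaDeriv_apply (hΦ : StripFlow Φ) {x : ℝ × ℝ} (hx : x ∈ strip) :
    ∃ c > 0, ∀ w, orbitAreaDeriv Φ x w = c * planeDet w (flowVel Φ (0, x)) := by
  have hL : Continuous fun r => flowDeriv Φ (r, x) :=
    hΦ.continuousOn_flowDeriv.continuous_left_of_strip hx
  have hc : Continuous fun r => planeJac (flowDeriv Φ (r, x)) :=
    (hL.clm_apply continuous_const).planeDet (hL.clm_apply continuous_const)
  refine ⟨(2 * Real.pi)⁻¹ * ∫ s in (0)..(2 * Real.pi), planeJac (flowDeriv Φ (s, x)),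
    mul_pos (inv_pos.mpr Real.two_pi_pos) (intervalIntegral.intervalIntegral_pos_of_pos
      (hc.intervalIntegrable _ _) (fun s => hΦ.planeJac_flowDeriv_pos s hx) Real.two_pi_pos),
    fun w => ?_⟩
  have hF : Continuous fun s => planeDetForm (flowDeriv Φ (s, x)) (flowVel Φ (s, x)) :=
    hΦ.continuousOn_planeDetForm.continuous_left_of_strip hx
  rw [orbitAreaDeriv, smul_apply,
    ContinuousLinearMap.intervalIntegral_apply (hF.intervalIntegrable _ _), smul_eq_mul, mul_assoc,
    ← intervalIntegral.integral_mul_const]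
  congr 1
  refine intervalIntegral.integral_congr fun s _ => ?_
  simp only [planeDetForm_apply]
  -- Invariance of the velocity makes both vectors images under the same linear map, so the
  -- determinant factors and only the Jacobian depends on `s`.
  rw [← hΦ.flowDeriv_flowVel s hx, planeDet_map]

end StripFlow

/-! ### Periodic flows -/

/-- A flow on the strip that induces an action of the circle on the cylinder without fixed points,
with orbits of degree `j`. -/
structure PeriodicStripFlow (Φ : ℝ × (ℝ × ℝ) → ℝ × ℝ) (j : ℝ) : Prop extends StripFlow Φ where
  period : ∀ x ∈ strip, Φ (2 * Real.pi, x) = (x.1, x.2 + 2 * Real.pi * j)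
  translate : ∀ s, ∀ x ∈ strip,
    Φ (s, (x.1, x.2 + 2 * Real.pi)) = ((Φ (s, x)).1, (Φ (s, x)).2 + 2 * Real.pi)
  exists_ne : ∀ x ∈ strip, ∃ s, Φ (s, x) ≠ x

namespace PeriodicStripFlow

variable {Φ : ℝ × (ℝ × ℝ) → ℝ × ℝ} {j : ℝ}

theorem flowVel_ne_zero (hΦ : PeriodicStripFlow Φ j) {x : ℝ × ℝ} (hx : x ∈ strip) :
    flowVel Φ (0, x) ≠ 0 := fun h =>
  let ⟨s, hs⟩ := hΦ.exists_ne x hx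
  hs (hΦ.apply_eq_self_of_flowVel_eq_zero hx h s)

theorem flowVel_fst_of_boundary (hΦ : PeriodicStripFlow Φ j) (s : ℝ) {x : ℝ × ℝ}
    (hx : x.1 = 0 ∨ x.1 = 1) : (flowVel Φ (s, x)).1 = 0 := by
  have hxs : x ∈ strip := mem_strip.mpr (by rcases hx with h | h <;> rw [h] <;> norm_num)
  refine (hΦ.hasDerivAt_time_fst s hxs).unique ?_
  simp only [hΦ.fst_eq_of_boundary _ hx]
  exact hasDerivAt_const _ _

/-- With `j = 0` a boundary orbit would close up in the strip. Rolle's theorem then gives a time at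
which its second velocity component vanishes. The first one is zero on the boundary, so the point
would be at rest. -/
theorem degree_ne_zero (hΦ : PeriodicStripFlow Φ j) : j ≠ 0 := by
  rintro rfl
  have hx : ((0, 0) : ℝ × ℝ) ∈ strip := mem_strip.mpr (by simp)
  obtain ⟨c, _, hc⟩ := exists_hasDerivAt_eq_zero Real.two_pi_pos
    (f := fun s => (Φ (s, (0, 0))).2) (hΦ.continuous_time hx).snd.continuousOn
    (by simp [hΦ.period _ hx, hΦ.zero _ hx]) (fun s _ => hΦ.hasDerivAt_time_snd s hx)
  have h1 : flowVel Φ (c, (0, 0)) = 0 :=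
    Prod.ext (hΦ.flowVel_fst_of_boundary c (Or.inl rfl)) hc
  have h2 := hΦ.flowVel_apply_flow 0 c hx
  rw [zero_add, h1] at h2
  exact hΦ.flowVel_ne_zero (hΦ.mem c _ hx) h2

theorem apply_add_two_pi (hΦ : PeriodicStripFlow Φ j) (s : ℝ) {x : ℝ × ℝ} (hx : x ∈ strip) :
    Φ (s + 2 * Real.pi, x) = ((Φ (s, x)).1, (Φ (s, x)).2 + 2 * Real.pi * j) := by
  rw [add_comm, ← hΦ.add _ _ x hx, hΦ.period _ (hΦ.mem s x hx)]

theorem flowVel_add_two_pi (hΦ : PeriodicStripFlow Φ j) (s : ℝ) {x : ℝ × ℝ} (hx : x ∈ strip) :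
    flowVel Φ (s + 2 * Real.pi, x) = flowVel Φ (s, x) := by
  have h := (hΦ.hasDerivAt_time (s + 2 * Real.pi) hx).comp_add_const s (2 * Real.pi)
  refine HasDerivAt.unique (h.congr_of_eventuallyEq
    (Filter.Eventually.of_forall fun r => (hΦ.apply_add_two_pi r hx).symm)) ?_
  exact (hΦ.hasDerivAt_time_fst s hx).prodMk ((hΦ.hasDerivAt_time_snd s hx).add_const _)

theorem orbitArea_apply (hΦ : PeriodicStripFlow Φ j) (r : ℝ) {x : ℝ × ℝ} (hx : x ∈ strip) :
    orbitArea Φ (Φ (r, x)) = orbitArea Φ x := by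
  have hper : Function.Periodic (fun s => (Φ (s, x)).1 * (flowVel Φ (s, x)).2) (2 * Real.pi) :=
    fun s => by simp only [hΦ.apply_add_two_pi s hx, hΦ.flowVel_add_two_pi s hx]
  have h := hper.intervalIntegral_add_eq r 0
  simp only [orbitArea, hΦ.add _ _ x hx, hΦ.flowVel_apply_flow _ _ hx]
  rw [intervalIntegral.integral_comp_add_right fun s => (Φ (s, x)).1 * (flowVel Φ (s, x)).2]
  rw [zero_add, add_comm, h, zero_add]

/-- The function `Φ₂(s, x) - j s` is periodic, so its integral over a period does not depend on the
starting time. The linear part accounts for the shift `j r`. -/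
theorem orbitAngle_apply (hΦ : PeriodicStripFlow Φ j) (r : ℝ) {x : ℝ × ℝ} (hx : x ∈ strip) :
    orbitAngle Φ (Φ (r, x)) = orbitAngle Φ x + j * r := by
  have hper : Function.Periodic (fun s => (Φ (s, x)).2 - j * s) (2 * Real.pi) :=
    fun s => by simp only [hΦ.apply_add_two_pi s hx]; ring
  have h := hper.intervalIntegral_add_eq r 0
  have hc : Continuous fun s => (Φ (s, x)).2 := (hΦ.continuous_time hx).snd
  have hi : ∀ a b, IntervalIntegrable (fun s => (Φ (s, x)).2) MeasureTheory.volume a b :=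
    fun a b => hc.intervalIntegrable _ _
  have hi' : ∀ a b, IntervalIntegrable (fun s : ℝ => j * s) MeasureTheory.volume a b :=
    fun a b => (continuous_const.mul continuous_id).intervalIntegrable _ _
  rw [intervalIntegral.integral_sub (hi _ _) (hi' _ _),
    intervalIntegral.integral_sub (hi _ _) (hi' _ _)] at h
  have hlin : ∀ a b : ℝ, ∫ s in a..b, j * s = j * ((b ^ 2 - a ^ 2) / 2) := fun a b => by
    rw [← integral_id, ← intervalIntegral.integral_const_mul]
  rw [hlin, hlin] at h
  simp only [orbitAngle, hΦ.add _ _ x hx]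
  rw [intervalIntegral.integral_comp_add_right fun s => (Φ (s, x)).2, zero_add, add_comm _ r]
  have hpi := Real.two_pi_pos.ne'
  rw [zero_add] at h
  rw [inv_mul_eq_div, inv_mul_eq_div, div_eq_iff hpi, add_mul, div_mul_cancel₀ _ hpi]
  linear_combination h

theorem orbitAngleDeriv_flowVel (hΦ : PeriodicStripFlow Φ j) {x : ℝ × ℝ} (hx : x ∈ strip) :
    orbitAngleDeriv Φ x (flowVel Φ (0, x)) = j := by
  have h0 : Φ (0, x) = x := hΦ.zero x hx
  have h1 := hΦ.hasFDerivWithinAt_orbitAngle hx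
  have h2 := HasFDerivWithinAt.comp_hasDerivWithinAt (0 : ℝ) (s := Set.univ) (t := strip)
    (f := fun r => Φ (r, x)) (l := orbitAngle Φ) (l' := orbitAngleDeriv Φ x) (by rwa [h0])
    (hΦ.hasDerivAt_time 0 hx).hasDerivWithinAt fun r _ => hΦ.mem r x hx
  rw [hasDerivWithinAt_univ] at h2
  refine h2.unique ?_
  have h3 : orbitAngle Φ ∘ (fun r => Φ (r, x)) = fun r => orbitAngle Φ x + j * r :=
    funext fun r => hΦ.orbitAngle_apply r hx
  rw [h3]
  simpa using ((hasDerivAt_id (0 : ℝ)).const_mul j).const_add (orbitAngle Φ x)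

theorem integral_flowVel_snd (hΦ : PeriodicStripFlow Φ j) {x : ℝ × ℝ} (hx : x ∈ strip) :
    ∫ s in (0)..(2 * Real.pi), (flowVel Φ (s, x)).2 = 2 * Real.pi * j := by
  rw [intervalIntegral.integral_eq_sub_of_hasDerivAt (fun s _ => hΦ.hasDerivAt_time_snd s hx)
    ((hΦ.continuous_flowVel hx).snd.intervalIntegrable _ _), hΦ.period x hx, hΦ.zero x hx]
  ring

/-- On a boundary orbit the first coordinate is constant and the total rise is `2πj`. -/
theorem orbitArea_of_boundary (hΦ : PeriodicStripFlow Φ j) {x : ℝ × ℝ} (hx : x.1 = 0 ∨ x.1 = 1) :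
    orbitArea Φ x = x.1 * j := by
  have hxs : x ∈ strip := mem_strip.mpr (by rcases hx with h | h <;> rw [h] <;> norm_num)
  simp only [orbitArea, hΦ.fst_eq_of_boundary _ hx]
  rw [intervalIntegral.integral_const_mul, hΦ.integral_flowVel_snd hxs]
  have := Real.pi_ne_zero
  field_simp

theorem orbitArea_translate (hΦ : PeriodicStripFlow Φ j) {c : ℝ} (hc : ∀ s, ∀ x ∈ strip,
      Φ (s, (x.1, x.2 + c)) = ((Φ (s, x)).1, (Φ (s, x)).2 + c)) {x : ℝ × ℝ} (hx : x ∈ strip) :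
    orbitArea Φ (x.1, x.2 + c) = orbitArea Φ x := by
  have hv : ∀ s, flowVel Φ (s, (x.1, x.2 + c)) = flowVel Φ (s, x) := fun s => by
    have h := hΦ.hasDerivAt_time s (x := (x.1, x.2 + c)) hx
    simp only [hc _ x hx] at h
    exact h.unique ((hΦ.hasDerivAt_time_fst s hx).prodMk
      ((hΦ.hasDerivAt_time_snd s hx).add_const _))
  simp only [orbitArea, hc _ x hx, hv]

theorem orbitAngle_eq_add (hΦ : PeriodicStripFlow Φ j) {c : ℝ} {x y : ℝ × ℝ}
    (hx : x ∈ strip) (hc : ∀ s, (Φ (s, y)).2 = (Φ (s, x)).2 + c) :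
    orbitAngle Φ y = orbitAngle Φ x + c := by
  simp only [orbitAngle, hc]
  rw [intervalIntegral.integral_add ((hΦ.continuous_time hx).snd.intervalIntegrable _ _)
    (continuous_const.intervalIntegrable _ _), intervalIntegral.integral_const]
  have := Real.pi_ne_zero
  simp only [sub_zero, smul_eq_mul]
  field_simp

/-- Replacing `t` by `1 - t` replaces the area under the orbit by its complement in the total `j`.
This is what lets the coordinates descend to the Möbius band. -/
theorem orbitArea_reflect (hΦ : PeriodicStripFlow Φ j) {c : ℝ} (hc : ∀ s, ∀ x ∈ strip,
      Φ (s, (1 - x.1, x.2 + c)) = (1 - (Φ (s, x)).1, (Φ (s, x)).2 + c)) {x : ℝ × ℝ}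
    (hx : x ∈ strip) : orbitArea Φ (1 - x.1, x.2 + c) = j - orbitArea Φ x := by
  have hx' : (1 - x.1, x.2 + c) ∈ strip := by
    have := mem_strip.mp hx
    exact mem_strip.mpr ⟨by linarith, by linarith⟩
  have hv : ∀ s, (flowVel Φ (s, (1 - x.1, x.2 + c))).2 = (flowVel Φ (s, x)).2 := fun s => by
    have h := hΦ.hasDerivAt_time_snd s hx'
    simp only [hc _ x hx] at h
    exact h.unique ((hΦ.hasDerivAt_time_snd s hx).add_const _)
  have h1 : Continuous fun s => (flowVel Φ (s, x)).2 := (hΦ.continuous_flowVel hx).snd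
  have h2 : Continuous fun s => (Φ (s, x)).1 * (flowVel Φ (s, x)).2 :=
    (hΦ.continuous_time hx).fst.mul h1
  simp only [orbitArea, hc _ x hx, hv, sub_mul, one_mul]
  rw [intervalIntegral.integral_sub (h1.intervalIntegrable _ _) (h2.intervalIntegrable _ _),
    hΦ.integral_flowVel_snd hx, mul_sub, ← mul_assoc, inv_mul_cancel₀ Real.two_pi_pos.ne', one_mul]

end PeriodicStripFlow

/-! ### Immersions of the strip are injective, with `C^1` inverse -/

theorem translate_mem_strip {x : ℝ × ℝ} (hx : x ∈ strip) (c : ℝ) : (x.1, x.2 + c) ∈ strip :=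
  ⟨hx.1, trivial⟩

theorem mem_strip_of_boundary {x : ℝ × ℝ} (hx : x.1 = 0 ∨ x.1 = 1) : x ∈ strip :=
  mem_strip.mpr (by rcases hx with h | h <;> rw [h] <;> norm_num)

/-- A map that is injective near each point at which its derivative is injective, on a convex set
on which it is continuously differentiable. -/
theorem Convex.exists_nhds_injOn {E F : Type*} [NormedAddCommGroup E] [NormedSpace ℝ E]
    [FiniteDimensional ℝ E] [NormedAddCommGroup F] [NormedSpace ℝ F] {S : Set E} (hS : Convex ℝ S)
    {f : E → F} {f' : E → E →L[ℝ] F} (hf : ∀ x ∈ S, HasFDerivWithinAt f (f' x) S x)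
    (hf' : ContinuousOn f' S) {x : E} (hx : x ∈ S) (hinj : Function.Injective (f' x)) :
    ∃ W ∈ nhds x, Set.InjOn f (S ∩ W) := by
  obtain ⟨K, hK, hanti⟩ := (f' x).toLinearMap.exists_antilipschitzWith
    (LinearMap.ker_eq_bot.mpr hinj)
  have hK' : (0 : ℝ) < K := hK
  -- The derivative at `x` expands by at least `1 / K`. Where it varies by less than half of that,
  -- `f` stays close enough to its linear part to be injective.
  obtain ⟨δ, hδ, hball⟩ := Metric.continuousWithinAt_iff.mp (hf' x hx) ((2 * (K : ℝ))⁻¹)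
    (by positivity)
  refine ⟨Metric.ball x δ, Metric.ball_mem_nhds x hδ, fun a ha b hb hab => ?_⟩
  have h1 := (hS.inter (convex_ball x δ)).norm_image_sub_le_of_norm_hasFDerivWithin_le'
    (fun z hz => (hf z hz.1).mono Set.inter_subset_left)
    (fun z hz => (dist_eq_norm (f' z) (f' x) ▸ hball hz.1 hz.2).le) ha hb
  rw [hab, sub_self, zero_sub, norm_neg] at h1
  have h2 := hanti.le_mul_dist (b - a) 0
  rw [map_zero, dist_zero_right, dist_zero_right] at h2
  have h3 : ‖b - a‖ ≤ ‖b - a‖ / 2 := by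
    calc ‖b - a‖ ≤ K * ‖f' x (b - a)‖ := h2
      _ ≤ K * ((2 * (K : ℝ))⁻¹ * ‖b - a‖) := by gcongr
      _ = ‖b - a‖ / 2 := by field_simp
  have h4 : ‖b - a‖ = 0 := le_antisymm (by linarith) (norm_nonneg _)
  exact (sub_eq_zero.mp (norm_eq_zero.mp h4)).symm

/-- A maximum principle for periodic functions on the strip. -/
theorem le_of_le_boundary_strip {g : ℝ × ℝ → ℝ} (hg : ContinuousOn g strip)
    (hper : ∀ x ∈ strip, ∀ n : ℤ, g (x.1, x.2 + n * (2 * Real.pi)) = g x) {C : ℝ}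
    (hb : ∀ x : ℝ × ℝ, x.1 = 0 ∨ x.1 = 1 → g x ≤ C)
    (hmax : ∀ x : ℝ × ℝ, 0 < x.1 → x.1 < 1 → ¬ IsLocalMax g x) {x : ℝ × ℝ} (hx : x ∈ strip) :
    g x ≤ C := by
  have hpi := Real.two_pi_pos
  have hK : IsCompact (Set.Icc (0 : ℝ) 1 ×ˢ Set.Icc 0 (2 * Real.pi)) :=
    isCompact_Icc.prod isCompact_Icc
  have hKS : Set.Icc (0 : ℝ) 1 ×ˢ Set.Icc 0 (2 * Real.pi) ⊆ strip := fun y hy => ⟨hy.1, trivial⟩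
  obtain ⟨m, hm, hmmax⟩ := hK.exists_isMaxOn ⟨(0, 0), by simp [hpi.le]⟩ (hg.mono hKS)
  have hglob : ∀ y ∈ strip, g y ≤ g m := by
    intro y hy
    obtain ⟨n, hn, -⟩ := existsUnique_add_zsmul_mem_Ico hpi y.2 0
    rw [zero_add, zsmul_eq_mul] at hn
    rw [← hper y hy n]
    exact hmmax (Set.mk_mem_prod hy.1 ⟨hn.1, hn.2.le⟩)
  refine (hglob x hx).trans ?_
  have hms := mem_strip.mp (hKS hm)
  by_cases h0 : m.1 = 0
  · exact hb m (Or.inl h0)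
  by_cases h1 : m.1 = 1
  · exact hb m (Or.inr h1)
  have h0' := lt_of_le_of_ne hms.1 (Ne.symm h0)
  have h1' := lt_of_le_of_ne hms.2 h1
  exact absurd (Filter.mem_of_superset (strip_mem_nhds h0' h1') hglob) (hmax m h0' h1')

/-- A map of class `C^1` with invertible derivatives on the strip, which preserves the first
coordinate on the boundary and conjugates the translation by `2π` to a translation. -/
structure StripImmersion (F : ℝ × ℝ → ℝ × ℝ) (F' : ℝ × ℝ → ℝ × ℝ →L[ℝ] ℝ × ℝ) (c : ℝ) : Prop where
  hasFDerivWithinAt : ∀ x ∈ strip, HasFDerivWithinAt F (F' x) strip x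
  continuousOn_deriv : ContinuousOn F' strip
  injective_deriv : ∀ x ∈ strip, Function.Injective (F' x)
  boundary : ∀ x : ℝ × ℝ, x.1 = 0 ∨ x.1 = 1 → (F x).1 = x.1
  translate : ∀ x ∈ strip, F (x.1, x.2 + 2 * Real.pi) = ((F x).1, (F x).2 + c)
  ne_zero : c ≠ 0

namespace StripImmersion

variable {F : ℝ × ℝ → ℝ × ℝ} {F' : ℝ × ℝ → ℝ × ℝ →L[ℝ] ℝ × ℝ} {c : ℝ}

theorem continuousOn (hF : StripImmersion F F' c) : ContinuousOn F strip :=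
  fun x hx => (hF.hasFDerivWithinAt x hx).continuousWithinAt

theorem contDiffOn (hF : StripImmersion F F' c) : ContDiffOn ℝ 1 F strip := by
  rw [← zero_add (1 : WithTop ℕ∞), contDiffOn_succ_iff_fderivWithin uniqueDiffOn_strip]
  refine ⟨fun x hx => (hF.hasFDerivWithinAt x hx).differentiableWithinAt, by simp, ?_⟩
  rw [contDiffOn_zero]
  exact hF.continuousOn_deriv.congr fun x hx =>
    (hF.hasFDerivWithinAt x hx).fderivWithin (uniqueDiffOn_strip x hx)

theorem surjective_deriv (hF : StripImmersion F F' c) {x : ℝ × ℝ} (hx : x ∈ strip) :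
    Function.Surjective (F' x) :=
  (LinearMap.injective_iff_surjective (f := (F' x).toLinearMap)).mp (hF.injective_deriv x hx)

theorem translate_int (hF : StripImmersion F F' c) {x : ℝ × ℝ} (hx : x ∈ strip) (n : ℤ) :
    F (x.1, x.2 + n * (2 * Real.pi)) = ((F x).1, (F x).2 + n * c) := by
  have hper : Function.Periodic (fun y => F (x.1, y) - (0, y / (2 * Real.pi) * c))
      (2 * Real.pi) := fun y => by
    have := Real.pi_ne_zero
    simp only [hF.translate (x.1, y) hx]
    ext
    · simp
    · simp only [Prod.snd_sub]
      field_simp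
      ring
  have h := hper.int_mul n x.2
  have := Real.pi_ne_zero
  have h1 := congrArg Prod.fst h
  have h2 := congrArg Prod.snd h
  simp only [Prod.fst_sub, Prod.snd_sub, sub_zero] at h1 h2
  refine Prod.ext h1 ?_
  rw [sub_eq_iff_eq_add] at h2
  rw [h2]
  field_simp
  ring

theorem not_isLocalExtr (hF : StripImmersion F F' c) {x : ℝ × ℝ} (h0 : 0 < x.1) (h1 : x.1 < 1) :
    ¬ IsLocalExtr (fun y => (F y).1) x := by
  have hx : x ∈ strip := mem_strip.mpr ⟨h0.le, h1.le⟩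
  have hd : HasFDerivAt (fun y => (F y).1) ((ContinuousLinearMap.fst ℝ ℝ ℝ).comp (F' x)) x :=
    (ContinuousLinearMap.fst ℝ ℝ ℝ).hasFDerivAt.comp x
      ((hF.hasFDerivWithinAt x hx).hasFDerivAt (strip_mem_nhds h0 h1))
  intro h
  obtain ⟨w, hw⟩ := hF.surjective_deriv hx (1, 0)
  have := DFunLike.congr_fun (h.hasFDerivAt_eq_zero hd) w
  simp [hw] at this

/-- Maximum principle for the first coordinate and its negative: both are periodic, are known on the
boundary, and have no interior extremum because the derivative is onto. -/
theorem mem (hF : StripImmersion F F' c) {x : ℝ × ℝ} (hx : x ∈ strip) : F x ∈ strip := by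
  refine mem_strip.mpr ⟨?_, ?_⟩
  · have := le_of_le_boundary_strip (g := fun y => -(F y).1) (C := 0) hF.continuousOn.fst.neg
      (fun y hy n => by rw [hF.translate_int hy])
      (fun y hy => by rw [hF.boundary y hy]; rcases hy with h | h <;> rw [h] <;> norm_num)
      (fun y h0 h1 h => hF.not_isLocalExtr h0 h1
        (Or.inl (show IsLocalMin _ y by simpa using h.neg))) hx
    simpa using this
  · exact le_of_le_boundary_strip (g := fun y => (F y).1) hF.continuousOn.fst
      (fun y hy n => by rw [hF.translate_int hy])
      (fun y hy => by rw [hF.boundary y hy]; rcases hy with h | h <;> rw [h]; norm_num)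
      (fun y h0 h1 h => hF.not_isLocalExtr h0 h1 (Or.inr h)) hx

theorem interior (hF : StripImmersion F F' c) {x : ℝ × ℝ} (h0 : 0 < x.1) (h1 : x.1 < 1) :
    0 < (F x).1 ∧ (F x).1 < 1 := by
  have hx : x ∈ strip := mem_strip.mpr ⟨h0.le, h1.le⟩
  have hm := mem_strip.mp (hF.mem hx)
  have hn := strip_mem_nhds h0 h1
  constructor
  · refine lt_of_le_of_ne hm.1 fun h => hF.not_isLocalExtr h0 h1 (Or.inl ?_)
    exact Filter.mem_of_superset hn fun y hy => h.symm.trans_le (mem_strip.mp (hF.mem hy)).1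
  · refine lt_of_le_of_ne hm.2 fun h => hF.not_isLocalExtr h0 h1 (Or.inr ?_)
    exact Filter.mem_of_superset hn fun y hy => (mem_strip.mp (hF.mem hy)).2.trans_eq h.symm

/-- Along a boundary line the image stays on that line, so by injectivity of the derivative the
second coordinate has nonzero derivative. Rolle's theorem excludes equal values. -/
theorem eq_of_boundary (hF : StripImmersion F F' c) {x y : ℝ × ℝ} (hx : x.1 = 0 ∨ x.1 = 1)
    (h : F x = F y) (hxy : x.1 = y.1) : x = y := by
  have hd : ∀ s, HasDerivAt (fun s => (F (x.1, s)).2) (F' (x.1, s) (0, 1)).2 s := by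
    intro s
    have h1 : HasDerivWithinAt (fun s : ℝ => (x.1, s)) (0, 1) Set.univ s :=
      ((hasDerivAt_const s x.1).prodMk (hasDerivAt_id s)).hasDerivWithinAt
    have h2 := (hF.hasFDerivWithinAt (x.1, s) (mem_strip_of_boundary hx)).comp_hasDerivWithinAt s h1
      (show Set.MapsTo _ _ strip from fun _ _ => mem_strip_of_boundary hx)
    exact (hasFDerivAt_snd (𝕜 := ℝ) (E := ℝ) (F := ℝ)).comp_hasDerivAt s
      (hasDerivWithinAt_univ.mp h2)
  have hd1 : ∀ s, (F' (x.1, s) (0, 1)).1 = 0 := by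
    intro s
    have h1 : HasDerivWithinAt (fun s : ℝ => (x.1, s)) (0, 1) Set.univ s :=
      ((hasDerivAt_const s x.1).prodMk (hasDerivAt_id s)).hasDerivWithinAt
    have h2 := (hF.hasFDerivWithinAt (x.1, s) (mem_strip_of_boundary hx)).comp_hasDerivWithinAt s h1
      (show Set.MapsTo _ _ strip from fun _ _ => mem_strip_of_boundary hx)
    have h3 := (hasFDerivAt_fst (𝕜 := ℝ) (E := ℝ) (F := ℝ)).comp_hasDerivAt s
      (hasDerivWithinAt_univ.mp h2)
    refine HasDerivAt.unique (h3.congr_of_eventuallyEq (Filter.Eventually.of_forall fun r => ?_))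
      (hasDerivAt_const s x.1)
    exact (hF.boundary (x.1, r) hx).symm
  have hne : ∀ s, (F' (x.1, s) (0, 1)).2 ≠ 0 := by
    intro s hs
    have h0 : F' (x.1, s) (0, 1) = F' (x.1, s) 0 := by
      rw [map_zero]
      exact Prod.ext (hd1 s) hs
    have := congrArg Prod.snd (hF.injective_deriv (x.1, s) (mem_strip_of_boundary hx) h0)
    simp at this
  have key : ∀ a b : ℝ, a < b → F (x.1, a) ≠ F (x.1, b) := by
    intro a b hab heq
    obtain ⟨s, _, hs⟩ := exists_hasDerivAt_eq_zero hab
      (fun s _ => (hd s).continuousAt.continuousWithinAt) (congrArg Prod.snd heq)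
      (fun s _ => hd s)
    exact hne s hs
  have h' : F (x.1, x.2) = F (x.1, y.2) := by
    rw [Prod.mk.eta, h, hxy]
  refine Prod.ext hxy ?_
  rcases lt_trichotomy x.2 y.2 with hlt | heq | hgt
  · exact absurd h' (key _ _ hlt)
  · exact heq
  · exact absurd h'.symm (key _ _ hgt)

theorem map_nhds (hF : StripImmersion F F' c) {x : ℝ × ℝ} (h0 : 0 < x.1) (h1 : x.1 < 1) :
    Filter.map F (nhds x) = nhds (F x) := by
  have hx : x ∈ strip := mem_strip.mpr ⟨h0.le, h1.le⟩
  have hn := strip_mem_nhds h0 h1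
  have hd := ((hF.hasFDerivWithinAt x hx).hasFDerivAt hn)
  have hs := (hF.contDiffOn.contDiffAt hn).hasStrictFDerivAt' hd one_ne_zero
  exact hs.map_nhds_eq_of_surj (LinearMap.range_eq_top.mpr (hF.surjective_deriv hx))

/-- The second coordinate changes by a bounded amount, up to scaling. -/
theorem exists_bound (hF : StripImmersion F F' c) :
    ∃ B, ∀ x ∈ strip, |x.2 - 2 * Real.pi / c * (F x).2| ≤ B := by
  have hpi := Real.two_pi_pos
  have hK : IsCompact (Set.Icc (0 : ℝ) 1 ×ˢ Set.Icc 0 (2 * Real.pi)) :=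
    isCompact_Icc.prod isCompact_Icc
  have hKS : Set.Icc (0 : ℝ) 1 ×ˢ Set.Icc 0 (2 * Real.pi) ⊆ strip := fun y hy => ⟨hy.1, trivial⟩
  have hc : ContinuousOn (fun x : ℝ × ℝ => x.2 - 2 * Real.pi / c * (F x).2) strip :=
    continuousOn_snd.sub (continuousOn_const.mul hF.continuousOn.snd)
  obtain ⟨B, hB⟩ := hK.exists_bound_of_continuousOn (hc.mono hKS)
  refine ⟨B, fun x hx => ?_⟩
  obtain ⟨n, hn, -⟩ := existsUnique_add_zsmul_mem_Ico hpi x.2 0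
  rw [zero_add, zsmul_eq_mul] at hn
  have h := hB (x.1, x.2 + n * (2 * Real.pi)) (Set.mk_mem_prod hx.1 ⟨hn.1, hn.2.le⟩)
  rw [hF.translate_int hx, Real.norm_eq_abs] at h
  refine (le_of_eq (congrArg abs ?_)).trans h
  have := hF.ne_zero
  field_simp
  ring

end StripImmersion

namespace StripImmersion

variable {F : ℝ × ℝ → ℝ × ℝ} {F' : ℝ × ℝ → ℝ × ℝ →L[ℝ] ℝ × ℝ} {c : ℝ}

/-- Up to translation, the pairs of distinct points with the same image form a compact set. If it is
nonempty, take a pair whose image has the least first coordinate. Both points are interior by the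
boundary behaviour, and `F` is open near each of them, so the image can be moved further to the
left. -/
theorem injOn (hF : StripImmersion F F' c) : Set.InjOn F strip := by
  have hpi := Real.two_pi_pos
  obtain ⟨B, hB⟩ := hF.exists_bound
  set K : Set (ℝ × ℝ) := Set.Icc (0 : ℝ) 1 ×ˢ Set.Icc 0 (2 * Real.pi) with hKdef
  -- Points with the same image have second coordinates within `2 * B` of each other. Once the first
  -- point is translated into `K`, the second lies in `K'`.
  set K' : Set (ℝ × ℝ) := Set.Icc (0 : ℝ) 1 ×ˢ Set.Icc (-(2 * B)) (2 * Real.pi + 2 * B) with hK'def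
  have hK : IsCompact K := isCompact_Icc.prod isCompact_Icc
  have hK' : IsCompact K' := isCompact_Icc.prod isCompact_Icc
  have hKS : K ⊆ strip := fun y hy => ⟨hy.1, trivial⟩
  have hKS' : K' ⊆ strip := fun y hy => ⟨hy.1, trivial⟩
  set N : Set ((ℝ × ℝ) × (ℝ × ℝ)) := {p | p ∈ K ×ˢ K' ∧ F p.1 = F p.2 ∧ p.1 ≠ p.2} with hN
  have hmemN : ∀ a ∈ strip, ∀ b ∈ strip, F a = F b → a ≠ b →
      ∃ p ∈ N, (F p.1).1 = (F a).1 := by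
    intro a ha b hb hab hne
    obtain ⟨n, hn, -⟩ := existsUnique_add_zsmul_mem_Ico hpi a.2 0
    rw [zero_add, zsmul_eq_mul] at hn
    refine ⟨((a.1, a.2 + n * (2 * Real.pi)), (b.1, b.2 + n * (2 * Real.pi))),
      ⟨⟨⟨ha.1, hn.1, hn.2.le⟩, ⟨hb.1, ?_⟩⟩, ?_, ?_⟩, ?_⟩
    · have h1 := abs_le.mp (hB a ha)
      have h2 := abs_le.mp (hB b hb)
      rw [hab] at h1
      constructor
      · dsimp only
        linarith [hn.1]
      · dsimp only
        linarith [hn.2]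
    · simp only [hF.translate_int ha, hF.translate_int hb, hab]
    · intro h
      have h1 := congrArg Prod.fst h
      have h2 := congrArg Prod.snd h
      simp only at h1 h2
      exact hne (Prod.ext h1 (by linarith))
    · simp only [hF.translate_int ha]
  have hcl : IsClosed N := by
    have hZ : IsClosed ((K ×ˢ K') ∩ (fun p : (ℝ × ℝ) × (ℝ × ℝ) => F p.1 - F p.2) ⁻¹' {0}) := by
      refine ContinuousOn.preimage_isClosed_of_isClosed ?_ (hK.prod hK').isClosed isClosed_singleton
      exact (hF.continuousOn.comp continuousOn_fst fun p hp => hKS hp.1).sub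
        (hF.continuousOn.comp continuousOn_snd fun p hp => hKS' hp.2)
    refine isClosed_of_closure_subset fun p hp => ?_
    have hNZ : N ⊆ (K ×ˢ K') ∩ (fun p : (ℝ × ℝ) × (ℝ × ℝ) => F p.1 - F p.2) ⁻¹' {0} :=
      fun q hq => ⟨hq.1, sub_eq_zero.mpr hq.2.1⟩
    have hpZ := closure_minimal hNZ hZ hp
    refine ⟨hpZ.1, sub_eq_zero.mp hpZ.2, fun heq => ?_⟩
    have hps : p.1 ∈ strip := hKS hpZ.1.1
    -- A limit of such pairs could only be lost by collapsing to the diagonal, which local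
    -- injectivity forbids, including at boundary points.
    obtain ⟨W, hW, hinj⟩ := convex_strip.exists_nhds_injOn hF.hasFDerivWithinAt
      hF.continuousOn_deriv hps (hF.injective_deriv _ hps)
    have hWW : W ×ˢ W ∈ nhds p := by
      have : p = (p.1, p.1) := Prod.ext rfl heq.symm
      rw [this]
      exact prod_mem_nhds hW hW
    obtain ⟨q, hqW, hqN⟩ := mem_closure_iff_nhds.mp hp _ hWW
    exact hqN.2.2 (hinj ⟨hKS hqN.1.1, hqW.1⟩ ⟨hKS' hqN.1.2, hqW.2⟩ hqN.2.1)
  have hcomp : IsCompact N := (hK.prod hK').of_isClosed_subset hcl fun p hp => hp.1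
  intro a ha b hb hab
  by_contra hne
  obtain ⟨p0, hp0, -⟩ := hmemN a ha b hb hab hne
  have hcont : ContinuousOn (fun p : (ℝ × ℝ) × (ℝ × ℝ) => (F p.1).1) N :=
    (hF.continuousOn.comp continuousOn_fst fun p hp => hKS hp.1.1).fst
  obtain ⟨p, hp, hmin⟩ := hcomp.exists_isMinOn ⟨p0, hp0⟩ hcont
  obtain ⟨hpK, hpF, hpne⟩ := hp
  have hint : ∀ x ∈ strip, (x.1 = 0 ∨ x.1 = 1) ∨ (0 < x.1 ∧ x.1 < 1) := by
    intro x hx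
    have h := mem_strip.mp hx
    rcases h.1.eq_or_lt with h0 | h0
    · exact Or.inl (Or.inl h0.symm)
    · rcases h.2.eq_or_lt with h1 | h1
      · exact Or.inl (Or.inr h1)
      · exact Or.inr ⟨h0, h1⟩
  have hF1 : (F p.1).1 = (F p.2).1 := by rw [hpF]
  rcases hint p.1 (hKS hpK.1) with h1 | h1 <;> rcases hint p.2 (hKS' hpK.2) with h2 | h2
  · rw [hF.boundary _ h1, hF.boundary _ h2] at hF1
    exact hpne (hF.eq_of_boundary h1 hpF hF1)
  · have := hF.interior h2.1 h2.2
    rw [← hF1, hF.boundary _ h1] at this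
    rcases h1 with h1 | h1 <;> rw [h1] at this <;> norm_num at this
  · have := hF.interior h1.1 h1.2
    rw [hF1, hF.boundary _ h2] at this
    rcases h2 with h2 | h2 <;> rw [h2] at this <;> norm_num at this
  · obtain ⟨A, C, hA, hC, hAC⟩ := t2_separation_nhds hpne
    have hA' : F '' (A ∩ strip) ∈ nhds (F p.1) := by
      rw [← hF.map_nhds h1.1 h1.2]
      exact Filter.image_mem_map (Filter.inter_mem hA (strip_mem_nhds h1.1 h1.2))
    have hC' : F '' (C ∩ strip) ∈ nhds (F p.1) := by
      rw [hpF, ← hF.map_nhds h2.1 h2.2]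
      exact Filter.image_mem_map (Filter.inter_mem hC (strip_mem_nhds h2.1 h2.2))
    obtain ⟨δ, hδ, hball⟩ := Metric.mem_nhds_iff.mp (Filter.inter_mem hA' hC')
    -- A common value slightly to the left of the minimal one. Its preimages in the disjoint
    -- neighbourhoods `A` and `C` form a new pair.
    have hz : ((F p.1).1 - δ / 2, (F p.1).2) ∈ Metric.ball (F p.1) δ := by
      rw [Metric.mem_ball, Prod.dist_eq, dist_self, Real.dist_eq]
      simp [abs_of_pos (half_pos hδ), hδ]
    obtain ⟨⟨a', ha', hFa⟩, ⟨b', hb', hFb⟩⟩ := hball hz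
    obtain ⟨q, hq, hq1⟩ := hmemN a' ha'.2 b' hb'.2 (hFa.trans hFb.symm) fun h =>
      Set.disjoint_left.mp hAC ha'.1 (h ▸ hb'.1)
    have h3 := hmin hq
    simp only [Set.mem_ofPred_eq, hq1, hFa] at h3
    linarith

theorem exists_contDiffOn_inverse (hF : StripImmersion F F' c)
    (hsurj : Set.SurjOn F strip strip) :
    ∃ G : ℝ × ℝ → ℝ × ℝ, ContDiffOn ℝ 1 G strip ∧ (∀ u ∈ strip, G u ∈ strip) ∧
      (∀ x ∈ strip, G (F x) = x) ∧ ∀ u ∈ strip, F (G u) = u := by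
  classical
  obtain ⟨B, hB⟩ := hF.exists_bound
  set G := Function.invFunOn F strip with hG
  have hmem : ∀ u ∈ strip, G u ∈ strip := fun u hu => Function.invFunOn_mem (hsurj hu)
  have hright : ∀ u ∈ strip, F (G u) = u := fun u hu => Function.invFunOn_eq (hsurj hu)
  have hleft : ∀ x ∈ strip, G (F x) = x := fun x hx =>
    hF.injOn (hmem _ (hF.mem hx)) hx (hright _ (hF.mem hx))
  have hcont : ContinuousOn G strip := by
    intro u hu
    set R := |2 * Real.pi / c| * (|u.2| + 1) + B with hR
    set K : Set (ℝ × ℝ) := Set.Icc (0 : ℝ) 1 ×ˢ Set.Icc (-R) R with hK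
    have hKc : IsCompact K := isCompact_Icc.prod isCompact_Icc
    -- Near `u` the inverse takes values in the compact set `K`, by the bound `B`. By continuity of
    -- `F`, each of its cluster points there is a preimage of `u`, hence `G u`.
    refine hKc.tendsto_nhds_of_unique_mapClusterPt ?_ fun z hz hcl => ?_
    · filter_upwards [inter_mem_nhdsWithin strip (Metric.ball_mem_nhds u one_pos)] with v hv
      refine ⟨(hmem v hv.1).1, abs_le.mp ?_⟩
      have h1 := hB (G v) (hmem v hv.1)
      rw [hright v hv.1] at h1
      have h2 : |v.2| ≤ |u.2| + 1 := by
        have h3 : |v.2 - u.2| ≤ 1 := by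
          have := hv.2
          rw [Metric.mem_ball, Prod.dist_eq, max_lt_iff, Real.dist_eq, Real.dist_eq] at this
          exact this.2.le
        have := abs_add_le (v.2 - u.2) u.2
        rw [sub_add_cancel] at this
        linarith
      have h4 := abs_add_le ((G v).2 - 2 * Real.pi / c * v.2) (2 * Real.pi / c * v.2)
      rw [sub_add_cancel, abs_mul] at h4
      have h5 : |2 * Real.pi / c| * |v.2| ≤ |2 * Real.pi / c| * (|u.2| + 1) := by gcongr
      linarith
    · have hzs : z ∈ strip := ⟨hz.1, trivial⟩
      have hFc : Continuous fun x => F (clampStrip x) :=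
        hF.continuousOn.comp_continuous continuous_clampStrip clampStrip_mem
      have h1 := hcl.continuousAt_comp hFc.continuousAt
      have h2 : Filter.Tendsto ((fun x => F (clampStrip x)) ∘ G) (nhdsWithin u strip) (nhds u) := by
        refine (Filter.tendsto_id.mono_right nhdsWithin_le_nhds).congr' ?_
        filter_upwards [self_mem_nhdsWithin] with v hv
        simp [clampStrip_of_mem (hmem v hv), hright v hv]
      have h3 : F (clampStrip z) = u := by
        have : Filter.NeBot (nhds (F (clampStrip z)) ⊓ nhds u) :=
          Filter.NeBot.mono h1 (inf_le_inf_left _ h2)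
        exact eq_of_nhds_neBot this
      rw [clampStrip_of_mem hzs] at h3
      rw [← h3, hleft z hzs]
  let e : ∀ x ∈ strip, (ℝ × ℝ) ≃L[ℝ] ℝ × ℝ := fun x hx =>
    (LinearEquiv.ofInjectiveEndo (F' x).toLinearMap
      (hF.injective_deriv x hx)).toContinuousLinearEquiv
  have he : ∀ x hx, (e x hx : ℝ × ℝ →L[ℝ] ℝ × ℝ) = F' x := fun x hx => by ext <;> rfl
  have hder : ∀ u ∈ strip, HasFDerivWithinAt G (F' (G u)).inverse strip u := by
    intro u hu
    rw [← he (G u) (hmem u hu), ContinuousLinearMap.inverse_equiv]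
    refine HasFDerivWithinAt.of_local_left_inverse (f := F) (t := strip)
      (tendsto_nhdsWithin_iff.mpr ⟨hcont u hu, ?_⟩) ?_ hu ?_
    · filter_upwards [self_mem_nhdsWithin] with v hv using hmem v hv
    · rw [he _ (hmem u hu)]
      exact hF.hasFDerivWithinAt _ (hmem u hu)
    · filter_upwards [self_mem_nhdsWithin] with v hv using hright v hv
  refine ⟨G, ?_, hmem, hleft, hright⟩
  rw [← zero_add (1 : WithTop ℕ∞), contDiffOn_succ_iff_fderivWithin uniqueDiffOn_strip]
  refine ⟨fun u hu => (hder u hu).differentiableWithinAt, by simp, ?_⟩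
  rw [contDiffOn_zero]
  refine ContinuousOn.congr (f := fun u => (F' (G u)).inverse) (fun u hu => ?_) fun u hu =>
    (hder u hu).fderivWithin (uniqueDiffOn_strip u hu)
  have h1 : ContinuousAt ContinuousLinearMap.inverse (F' (G u)) := by
    rw [← he (G u) (hmem u hu)]
    exact (contDiffAt_map_inverse (n := 0) (e (G u) (hmem u hu))).continuousAt
  exact ContinuousAt.comp_continuousWithinAt (f := fun u => F' (G u)) h1
    (hF.continuousOn_deriv.comp hcont hmem u hu)

end StripImmersion

/-! ### Coordinates straightening the flow -/

/-- Coordinates in which the flow is a vertical translation: the area under the orbit and the mean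
of the second coordinate over the orbit. -/
noncomputable def orbitCoords (Φ : ℝ × (ℝ × ℝ) → ℝ × ℝ) (j : ℝ) (x : ℝ × ℝ) : ℝ × ℝ :=
  (j⁻¹ * orbitArea Φ x, j⁻¹ * orbitAngle Φ x)

/-- The derivative of `orbitCoords`. -/
noncomputable def orbitCoordsDeriv (Φ : ℝ × (ℝ × ℝ) → ℝ × ℝ) (j : ℝ) (x : ℝ × ℝ) :
    ℝ × ℝ →L[ℝ] ℝ × ℝ :=
  (j⁻¹ • orbitAreaDeriv Φ x).prod (j⁻¹ • orbitAngleDeriv Φ x)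

namespace PeriodicStripFlow

variable {Φ : ℝ × (ℝ × ℝ) → ℝ × ℝ} {j : ℝ}

/-- A vector killed by the derivative of the area is a multiple of the velocity, on which the
derivative of the angle is `j ≠ 0`. -/
theorem injective_orbitCoordsDeriv (hΦ : PeriodicStripFlow Φ j) {x : ℝ × ℝ} (hx : x ∈ strip) :
    Function.Injective (orbitCoordsDeriv Φ j x) := by
  rw [injective_iff_map_eq_zero]
  intro w hw
  have hj := inv_ne_zero hΦ.degree_ne_zero
  have h1 : j⁻¹ * orbitAreaDeriv Φ x w = 0 := congrArg Prod.fst hw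
  have h2 : j⁻¹ * orbitAngleDeriv Φ x w = 0 := congrArg Prod.snd hw
  obtain ⟨c, hc, hcw⟩ := hΦ.exists_orbitAreaDeriv_apply hx
  rw [hcw] at h1
  have h3 := (mul_eq_zero.mp ((mul_eq_zero.mp h1).resolve_left hj)).resolve_left hc.ne'
  obtain ⟨k, rfl⟩ := exists_smul_of_planeDet_eq_zero (hΦ.flowVel_ne_zero hx) h3
  have h4 := (mul_eq_zero.mp h2).resolve_left hj
  rw [map_smul, hΦ.orbitAngleDeriv_flowVel hx, smul_eq_mul] at h4
  rw [(mul_eq_zero.mp h4).resolve_right hΦ.degree_ne_zero, zero_smul]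

theorem orbitCoords_apply (hΦ : PeriodicStripFlow Φ j) (r : ℝ) {x : ℝ × ℝ} (hx : x ∈ strip) :
    orbitCoords Φ j (Φ (r, x)) = ((orbitCoords Φ j x).1, (orbitCoords Φ j x).2 + r) := by
  have hj := hΦ.degree_ne_zero
  simp only [orbitCoords, hΦ.orbitArea_apply r hx, hΦ.orbitAngle_apply r hx, mul_add,
    inv_mul_cancel_left₀ hj]

theorem orbitCoords_translate (hΦ : PeriodicStripFlow Φ j) {c : ℝ} (hc : ∀ s, ∀ x ∈ strip,
      Φ (s, (x.1, x.2 + c)) = ((Φ (s, x)).1, (Φ (s, x)).2 + c)) {x : ℝ × ℝ} (hx : x ∈ strip) :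
    orbitCoords Φ j (x.1, x.2 + c) = ((orbitCoords Φ j x).1, (orbitCoords Φ j x).2 + j⁻¹ * c) := by
  simp only [orbitCoords, hΦ.orbitArea_translate hc hx,
    hΦ.orbitAngle_eq_add hx fun s => congrArg Prod.snd (hc s x hx), mul_add]

theorem orbitCoords_reflect (hΦ : PeriodicStripFlow Φ j) {c : ℝ} (hc : ∀ s, ∀ x ∈ strip,
      Φ (s, (1 - x.1, x.2 + c)) = (1 - (Φ (s, x)).1, (Φ (s, x)).2 + c)) {x : ℝ × ℝ}
    (hx : x ∈ strip) : orbitCoords Φ j (1 - x.1, x.2 + c) =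
      (1 - (orbitCoords Φ j x).1, (orbitCoords Φ j x).2 + j⁻¹ * c) := by
  have hj := hΦ.degree_ne_zero
  simp only [orbitCoords, hΦ.orbitArea_reflect hc hx,
    hΦ.orbitAngle_eq_add hx fun s => congrArg Prod.snd (hc s x hx), mul_add, mul_sub,
    inv_mul_cancel₀ hj]

theorem stripImmersion (hΦ : PeriodicStripFlow Φ j) :
    StripImmersion (orbitCoords Φ j) (orbitCoordsDeriv Φ j) (j⁻¹ * (2 * Real.pi)) where
  hasFDerivWithinAt x hx := ((hΦ.hasFDerivWithinAt_orbitArea hΦ.period hx).const_mul j⁻¹).prodMk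
    ((hΦ.hasFDerivWithinAt_orbitAngle hx).const_mul j⁻¹)
  continuousOn_deriv := by
    have h1 := (continuousOn_const (c := j⁻¹)).smul hΦ.continuousOn_orbitAreaDeriv
    have h2 := (continuousOn_const (c := j⁻¹)).smul hΦ.continuousOn_orbitAngleDeriv
    exact (ContinuousLinearMap.prodₗᵢ ℝ).continuous.comp_continuousOn (h1.prodMk h2)
  injective_deriv x hx := hΦ.injective_orbitCoordsDeriv hx
  boundary x hx := by
    have hj := hΦ.degree_ne_zero
    simp only [orbitCoords, hΦ.orbitArea_of_boundary hx]
    field_simp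
  translate x hx := hΦ.orbitCoords_translate hΦ.translate hx
  ne_zero := mul_ne_zero (inv_ne_zero hΦ.degree_ne_zero) Real.two_pi_pos.ne'

/-- On the segment `[0,1] × {0}` the first coordinate of the image takes every value in `[0,1]`. The
flow then adjusts the second without changing the first. -/
theorem surjOn_orbitCoords (hΦ : PeriodicStripFlow Φ j) :
    Set.SurjOn (orbitCoords Φ j) strip strip := by
  intro u hu
  have hF := hΦ.stripImmersion
  have hc : ContinuousOn (fun t : ℝ => (orbitCoords Φ j (t, 0)).1) (Set.Icc 0 1) :=
    (hF.continuousOn.comp (by fun_prop) fun t ht => ⟨ht, trivial⟩).fst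
  have h := intermediate_value_Icc zero_le_one hc
  simp only [hF.boundary (0, 0) (Or.inl rfl), hF.boundary (1, 0) (Or.inr rfl)] at h
  obtain ⟨t, ht, htu⟩ := h hu.1
  have hts : (t, (0 : ℝ)) ∈ strip := ⟨ht, trivial⟩
  refine ⟨Φ (u.2 - (orbitCoords Φ j (t, 0)).2, (t, 0)), hΦ.mem _ _ hts, ?_⟩
  rw [hΦ.orbitCoords_apply _ hts]
  exact Prod.ext htu (by simp)

end PeriodicStripFlow

/-! ### Surfaces presented as quotients of the strip -/

/-- A continuous function with integer values is constant on a preconnected set. -/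
theorem IsPreconnected.eq_of_continuousOn_int {A : Type*} [TopologicalSpace A] {T : Set A}
    (hT : IsPreconnected T) {h : A → ℝ} (hh : ContinuousOn h T)
    (hint : ∀ a ∈ T, ∃ n : ℤ, h a = n) {a b : A} (ha : a ∈ T) (hb : b ∈ T) : h a = h b := by
  have hoc := (hT.image h hh).ordConnected
  have key : ∀ a ∈ T, ∀ b ∈ T, ¬ h a < h b := by
    intro a ha b hb hab
    obtain ⟨m, hm⟩ := hint a ha
    obtain ⟨n, hn⟩ := hint b hb
    have hmn : m + 1 ≤ n := by
      rw [hm, hn] at hab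
      exact_mod_cast hab
    have hmn' : (m : ℝ) + 1 ≤ n := by exact_mod_cast hmn
    obtain ⟨e, he, hev⟩ := hoc.out (Set.mem_image_of_mem h ha) (Set.mem_image_of_mem h hb)
      (show (m : ℝ) + 1 / 2 ∈ Set.Icc (h a) (h b) by rw [hm, hn]; constructor <;> linarith)
    obtain ⟨k, hk⟩ := hint e he
    rw [hk] at hev
    have h2 : (2 * k : ℝ) = 2 * m + 1 := by linarith
    have h3 : 2 * k = 2 * m + 1 := by exact_mod_cast h2
    omega
  exact le_antisymm (not_lt.mp (key b hb a ha)) (not_lt.mp (key a ha b hb))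

/-- A surface presented as a quotient of the strip by a group of isometries generated by a
translation, or by a glide reflection whose square is a translation, along the strip. -/
structure StripQuotient {X : Type*} [TopologicalSpace X]
    [ChartedSpace (ModelProd (EuclideanHalfSpace 1) (EuclideanSpace ℝ (Fin 1))) X]
    (q : ℝ × ℝ → X) : Prop where
  continuous : Continuous q
  contMDiffOn : ContMDiffOn 𝓘(ℝ, ℝ × ℝ) cylModel 1 q strip
  exists_section : ∀ p : X, ∃ g : X → ℝ × ℝ, ContMDiffAt cylModel 𝓘(ℝ, ℝ × ℝ) 1 g p ∧
    ∀ᶠ p' in nhds p, g p' ∈ strip ∧ q (g p') = p'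
  int : ∀ x ∈ strip, ∀ y ∈ strip, q x = q y → ∃ n : ℤ, y.2 = x.2 + n * Real.pi
  inj : ∀ x ∈ strip, ∀ y ∈ strip, q x = q y → x.2 = y.2 → x = y
  boundary : ∀ y y' : ℝ, q (0, y) = q (0, y') → ∃ n : ℤ, y' = y + 2 * Real.pi * n
  translate : ∀ x ∈ strip, q (x.1, x.2 + 2 * Real.pi) = q x
  fiber : ∀ x ∈ strip, ∀ y ∈ strip, q x = q y → ∃ c : ℝ,
    (y = (x.1, x.2 + c) ∧ ∀ z ∈ strip, q (z.1, z.2 + c) = q z) ∨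
    (y = (1 - x.1, x.2 + c) ∧ ∀ z ∈ strip, q (1 - z.1, z.2 + c) = q z)
  lift : ∀ f : ℝ × (ℝ × ℝ) → X, Continuous f → ∀ p₀, ∀ x₀ ∈ strip, q x₀ = f p₀ →
    ∃ g : ℝ × (ℝ × ℝ) → ℝ × ℝ, Continuous g ∧ (∀ p, g p ∈ strip) ∧ (∀ p, q (g p) = f p) ∧
      g p₀ = x₀ ∧ ∀ s, ContMDiffOn 𝓘(ℝ, ℝ × (ℝ × ℝ)) cylModel 1 f s → ContDiffOn ℝ 1 g s

theorem reflect_mem_strip {x : ℝ × ℝ} (hx : x ∈ strip) (c : ℝ) : (1 - x.1, x.2 + c) ∈ strip := by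
  have := mem_strip.mp hx
  exact mem_strip.mpr ⟨by linarith, by linarith⟩

namespace StripQuotient

variable {X : Type*} [TopologicalSpace X]
  [ChartedSpace (ModelProd (EuclideanHalfSpace 1) (EuclideanSpace ℝ (Fin 1))) X] {q : ℝ × ℝ → X}

theorem exists_mem (hq : StripQuotient q) (p : X) : ∃ x ∈ strip, q x = p := by
  obtain ⟨g, -, hg⟩ := hq.exists_section p
  exact ⟨g p, hg.self_of_nhds⟩

/-- Uniqueness of lifts. -/
theorem eqOn_of_comp_eq (hq : StripQuotient q) {A : Type*} [TopologicalSpace A] {T : Set A}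
    (hT : IsPreconnected T) {g₁ g₂ : A → ℝ × ℝ} (h₁ : ContinuousOn g₁ T) (h₂ : ContinuousOn g₂ T)
    (hm₁ : ∀ a ∈ T, g₁ a ∈ strip) (hm₂ : ∀ a ∈ T, g₂ a ∈ strip)
    (hqg : ∀ a ∈ T, q (g₁ a) = q (g₂ a)) {a₀ : A} (ha₀ : a₀ ∈ T) (h0 : g₁ a₀ = g₂ a₀) :
    ∀ a ∈ T, g₁ a = g₂ a := by
  intro a ha
  -- Two lifts differ in the second coordinate by an integer multiple of `π`, which is constant by
  -- connectedness. Points of a fibre with equal second coordinates coincide.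
  have hc : ContinuousOn (fun a => ((g₂ a).2 - (g₁ a).2) / Real.pi) T :=
    (h₂.snd.sub h₁.snd).div_const _
  have hint : ∀ a ∈ T, ∃ n : ℤ, ((g₂ a).2 - (g₁ a).2) / Real.pi = n := fun a ha => by
    obtain ⟨n, hn⟩ := hq.int _ (hm₁ a ha) _ (hm₂ a ha) (hqg a ha)
    refine ⟨n, ?_⟩
    rw [hn]
    have := Real.pi_ne_zero
    field_simp
    ring
  have h := hT.eq_of_continuousOn_int hc hint ha ha₀
  simp only [h0, sub_self, zero_div, div_eq_zero_iff, Real.pi_ne_zero, or_false] at h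
  exact hq.inj _ (hm₁ a ha) _ (hm₂ a ha) (hqg a ha) (sub_eq_zero.mp h).symm

/-- A map of class `C^1` of the strip which respects the fibres induces a map of class `C^1`. -/
theorem exists_descend (hq : StripQuotient q) {f : ℝ × ℝ → ℝ × ℝ} (hf : ContDiffOn ℝ 1 f strip)
    (hm : ∀ x ∈ strip, f x ∈ strip)
    (hfib : ∀ x ∈ strip, ∀ y ∈ strip, q x = q y → q (f x) = q (f y)) :
    ∃ ψ : X → X, ContMDiff cylModel cylModel 1 ψ ∧ ∀ x ∈ strip, ψ (q x) = q (f x) := by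
  -- The choice `r` need not be continuous. Regularity is checked through the local sections, which
  -- give the same value because `f` respects fibres.
  choose r hr hqr using hq.exists_mem
  have hψ : ∀ x ∈ strip, q (f (r (q x))) = q (f x) := fun x hx =>
    hfib _ (hr _) x hx (hqr _)
  refine ⟨fun p => q (f (r p)), fun p => ?_, hψ⟩
  obtain ⟨g, hg, hgq⟩ := hq.exists_section p
  have hgp := hgq.self_of_nhds
  have h1 : ContMDiffWithinAt 𝓘(ℝ, ℝ × ℝ) cylModel 1 (q ∘ f) strip (g p) :=
    (hq.contMDiffOn.comp hf.contMDiffOn hm) (g p) hgp.1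
  have h2 : ContMDiffWithinAt cylModel cylModel 1 ((q ∘ f) ∘ g) (g ⁻¹' strip) p :=
    h1.comp p hg.contMDiffWithinAt (fun _ h => h)
  have h3 : ContMDiffAt cylModel cylModel 1 ((q ∘ f) ∘ g) p :=
    h2.contMDiffAt (hgq.mono fun _ h => h.1)
  refine h3.congr_of_eventuallyEq (hgq.mono fun p' h => ?_)
  have := hψ (g p') h.1
  rw [h.2] at this
  exact this

theorem translate_int (hq : StripQuotient q) {x : ℝ × ℝ} (hx : x ∈ strip) (n : ℤ) :
    q (x.1, x.2 + 2 * Real.pi * n) = q x := by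
  have hper : Function.Periodic (fun y => q (x.1, y)) (2 * Real.pi) := fun y =>
    hq.translate (x.1, y) hx
  have := hper.int_mul n x.2
  rwa [mul_comm] at this

/-! ### Lifting the action and descending the conjugacy -/

section Action

variable [MulAction Circle X]

/-- The lift of an action of the circle to a flow on the strip. -/
theorem exists_lift_action (hq : StripQuotient q)
    (hact : ContMDiff ((𝓡 1).prod cylModel) cylModel 1 (fun x : Circle × X => x.1 • x.2)) :
    ∃ Φ : ℝ × (ℝ × ℝ) → ℝ × ℝ, StripFlow Φ ∧
      ∀ s, ∀ x ∈ strip, q (Φ (s, x)) = Circle.exp s • q x := by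
  have hcf : Continuous fun p : ℝ × (ℝ × ℝ) => Circle.exp p.1 • q p.2 :=
    hact.continuous.comp ((Circle.exp.continuous.comp continuous_fst).prodMk
      (hq.continuous.comp continuous_snd))
  have hsf : ContMDiffOn 𝓘(ℝ, ℝ × (ℝ × ℝ)) cylModel 1
      (fun p : ℝ × (ℝ × ℝ) => Circle.exp p.1 • q p.2) (Set.univ ×ˢ strip) := by
    have h1 : ContMDiffOn 𝓘(ℝ, ℝ × (ℝ × ℝ)) (𝓡 1) 1
        (fun p : ℝ × (ℝ × ℝ) => Circle.exp p.1) (Set.univ ×ˢ strip) :=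
      (contMDiff_circleExp.comp contDiff_fst.contMDiff).contMDiffOn
    have h2 : ContMDiffOn 𝓘(ℝ, ℝ × (ℝ × ℝ)) cylModel 1
        (fun p : ℝ × (ℝ × ℝ) => q p.2) (Set.univ ×ˢ strip) :=
      hq.contMDiffOn.comp contDiff_snd.contMDiff.contMDiffOn fun p hp => hp.2
    exact hact.comp_contMDiffOn (h1.prodMk h2)
  have h00 : ((0, 0) : ℝ × ℝ) ∈ strip := mem_strip.mpr (by simp)
  obtain ⟨Φ, hΦc, hΦm, hΦq, hΦ0, hΦs⟩ := hq.lift _ hcf (0, (0, 0)) (0, 0) h00 (by simp)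
  -- Both the identity at time `0` and the group law follow from uniqueness of lifts.
  have hzero : ∀ x ∈ strip, Φ (0, x) = x :=
    hq.eqOn_of_comp_eq convex_strip.isPreconnected
      (hΦc.comp (continuous_const.prodMk continuous_id)).continuousOn continuousOn_id
      (fun x _ => hΦm _) (fun x hx => hx) (fun x _ => by simp [hΦq]) h00 hΦ0
  refine ⟨Φ, ⟨hΦs _ hsf, fun s x _ => hΦm _, hzero, fun a b x hx => ?_⟩, fun s x _ => hΦq _⟩
  refine hq.eqOn_of_comp_eq (A := ℝ) isPreconnected_univ
    (g₁ := fun a => Φ (a, Φ (b, x))) (g₂ := fun a => Φ (a + b, x))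
    (hΦc.comp (continuous_id.prodMk continuous_const)).continuousOn
    (hΦc.comp ((continuous_id.add continuous_const).prodMk continuous_const)).continuousOn
    (fun _ _ => hΦm _) (fun _ _ => hΦm _) (fun a _ => ?_) (Set.mem_univ 0) ?_ a (Set.mem_univ a)
  · simp only [hΦq, Circle.exp_add, mul_smul]
  · simp only [hzero _ (hΦm _), zero_add]

variable {Φ : ℝ × (ℝ × ℝ) → ℝ × ℝ}

theorem flow_translate (hq : StripQuotient q) (hΦ : StripFlow Φ)
    (hΦq : ∀ s, ∀ x ∈ strip, q (Φ (s, x)) = Circle.exp s • q x) {c : ℝ}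
    (hc : ∀ z ∈ strip, q (z.1, z.2 + c) = q z) (s : ℝ) (x : ℝ × ℝ) (hx : x ∈ strip) :
    Φ (s, (x.1, x.2 + c)) = ((Φ (s, x)).1, (Φ (s, x)).2 + c) := by
  have hx' := translate_mem_strip hx c
  have h := hΦ.continuous_time hx
  refine hq.eqOn_of_comp_eq (A := ℝ) isPreconnected_univ
    (g₁ := fun s => Φ (s, (x.1, x.2 + c))) (g₂ := fun s => ((Φ (s, x)).1, (Φ (s, x)).2 + c))
    (hΦ.continuous_time hx').continuousOn
    (h.fst.prodMk (h.snd.add continuous_const)).continuousOn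
    (fun _ _ => hΦ.mem _ _ hx') (fun _ _ => translate_mem_strip (hΦ.mem _ _ hx) c)
    (fun a _ => ?_) (Set.mem_univ 0) ?_ s (Set.mem_univ s)
  · simp only [hΦq _ _ hx', hc _ hx, hc _ (hΦ.mem a x hx), hΦq _ _ hx]
  · simp only [hΦ.zero _ hx, hΦ.zero _ hx']

theorem flow_reflect (hq : StripQuotient q) (hΦ : StripFlow Φ)
    (hΦq : ∀ s, ∀ x ∈ strip, q (Φ (s, x)) = Circle.exp s • q x) {c : ℝ}
    (hc : ∀ z ∈ strip, q (1 - z.1, z.2 + c) = q z) (s : ℝ) (x : ℝ × ℝ) (hx : x ∈ strip) :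
    Φ (s, (1 - x.1, x.2 + c)) = (1 - (Φ (s, x)).1, (Φ (s, x)).2 + c) := by
  have hx' := reflect_mem_strip hx c
  have h := hΦ.continuous_time hx
  refine hq.eqOn_of_comp_eq (A := ℝ) isPreconnected_univ
    (g₁ := fun s => Φ (s, (1 - x.1, x.2 + c))) (g₂ := fun s => (1 - (Φ (s, x)).1, (Φ (s, x)).2 + c))
    (hΦ.continuous_time hx').continuousOn
    ((continuous_const.sub h.fst).prodMk (h.snd.add continuous_const)).continuousOn
    (fun _ _ => hΦ.mem _ _ hx') (fun _ _ => reflect_mem_strip (hΦ.mem _ _ hx) c)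
    (fun a _ => ?_) (Set.mem_univ 0) ?_ s (Set.mem_univ s)
  · simp only [hΦq _ _ hx', hc _ hx, hc _ (hΦ.mem a x hx), hΦq _ _ hx]
  · simp only [hΦ.zero _ hx, hΦ.zero _ hx']

/-- The time-`2π` map lifts the identity, so it is determined by its value at `(0, 0)`. This value
lies on the same boundary line, which leaves only a translation by a multiple of `2π`. -/
theorem exists_periodicStripFlow (hq : StripQuotient q) (hΦ : StripFlow Φ)
    (hΦq : ∀ s, ∀ x ∈ strip, q (Φ (s, x)) = Circle.exp s • q x)
    (hfix : MulAction.fixedPoints Circle X = ∅) : ∃ n : ℤ, PeriodicStripFlow Φ n := by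
  have h00 : ((0, 0) : ℝ × ℝ) ∈ strip := mem_strip.mpr (by simp)
  have h1 := hΦ.fst_eq_of_boundary (2 * Real.pi) (x := (0, 0)) (Or.inl rfl)
  have h2 := hΦq (2 * Real.pi) (0, 0) h00
  rw [Circle.exp_two_pi, one_smul, ← Prod.mk.eta (p := Φ (2 * Real.pi, 0, 0)), h1] at h2
  obtain ⟨n, hn⟩ := hq.boundary _ _ h2.symm
  refine ⟨n, hΦ, ?_, fun s x hx => hq.flow_translate hΦ hΦq hq.translate s x hx, fun x hx => ?_⟩
  · refine hq.eqOn_of_comp_eq convex_strip.isPreconnected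
      (g₁ := fun x => Φ (2 * Real.pi, x)) (g₂ := fun x => (x.1, x.2 + 2 * Real.pi * n))
      (fun x hx => (hΦ.hasFDerivWithinAt_space _ hx).continuousWithinAt)
      (by fun_prop) (fun x hx => hΦ.mem _ x hx) (fun x hx => translate_mem_strip hx _)
      (fun x hx => ?_) h00 (Prod.ext h1 hn)
    rw [hΦq _ x hx, Circle.exp_two_pi, one_smul, hq.translate_int hx]
  · by_contra! h
    have : q x ∈ MulAction.fixedPoints Circle X := fun g => by
      obtain ⟨s, rfl⟩ := Circle.exp_surjective g
      rw [← hΦq s x hx, h s]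
    rw [hfix] at this
    exact this

/-- In the straightened coordinates the flow at time `2π / n` and the translation by `2π` agree, so
they are equal by injectivity. Hence `exp (2π / n)` acts trivially, and faithfulness makes `1 / n`
an integer. -/
theorem degree_sq_eq_one [FaithfulSMul Circle X] (hq : StripQuotient q) {n : ℤ}
    (hΦ : PeriodicStripFlow Φ n)
    (hΦq : ∀ s, ∀ x ∈ strip, q (Φ (s, x)) = Circle.exp s • q x) : n = 1 ∨ n = -1 := by
  have hn := hΦ.degree_ne_zero
  have h1 : ∀ x ∈ strip, Φ ((n : ℝ)⁻¹ * (2 * Real.pi), x) = (x.1, x.2 + 2 * Real.pi) := by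
    intro x hx
    refine hΦ.stripImmersion.injOn (hΦ.mem _ x hx) (translate_mem_strip hx _) ?_
    rw [hΦ.orbitCoords_apply _ hx, hΦ.orbitCoords_translate hΦ.translate hx]
  have h2 : Circle.exp ((n : ℝ)⁻¹ * (2 * Real.pi)) = 1 := by
    refine FaithfulSMul.eq_of_smul_eq_smul (α := X) fun p => ?_
    obtain ⟨x, hx, rfl⟩ := hq.exists_mem p
    rw [← hΦq _ x hx, h1 x hx, hq.translate x hx, one_smul]
  obtain ⟨m, hm⟩ := Circle.exp_eq_one.mp h2
  have h3 : (n : ℝ)⁻¹ = m := mul_right_cancel₀ Real.two_pi_pos.ne' hm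
  have h4 : (n * m : ℝ) = 1 := by rw [← h3, mul_inv_cancel₀ hn]
  exact Int.eq_one_or_neg_one_of_mul_eq_one (by exact_mod_cast h4)

/-- An action of the circle of class `C^1`, faithful and without fixed points, is conjugate to the
action by translations of the second coordinate of the strip. -/
theorem exists_conjugacy [FaithfulSMul Circle X] (hq : StripQuotient q)
    (hact : ContMDiff ((𝓡 1).prod cylModel) cylModel 1 (fun x : Circle × X => x.1 • x.2))
    (hfix : MulAction.fixedPoints Circle X = ∅) (rot : Circle → X → X)
    (hrot : ∀ s, ∀ x ∈ strip, rot (Circle.exp s) (q x) = q (x.1, x.2 + s)) :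
    ∃ ψ : Diffeomorph cylModel cylModel X X 1, ∀ (g : Circle) (p : X), ψ (rot g p) = g • ψ p := by
  obtain ⟨Φ, hΦ₀, hΦq⟩ := hq.exists_lift_action hact
  obtain ⟨n, hΦ⟩ := hq.exists_periodicStripFlow hΦ₀ hΦq hfix
  have hn := hq.degree_sq_eq_one hΦ hΦq
  have hn' : ((n : ℝ)⁻¹ = 1) ∨ ((n : ℝ)⁻¹ = -1) := by
    rcases hn with rfl | rfl <;> norm_num
  have hF := hΦ.stripImmersion
  set F := orbitCoords Φ n with hFdef
  obtain ⟨G, hGs, hGm, hGF, hFG⟩ := hF.exists_contDiffOn_inverse hΦ.surjOn_orbitCoords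
  -- The coordinates turn a deck transformation with shift `c` into the one with shift `n⁻¹ c = ±c`.
  -- For the sign `-1` this is its inverse, again a deck transformation.
  have hneg : ∀ c : ℝ, (∀ z ∈ strip, q (z.1, z.2 + c) = q z) →
      ∀ z ∈ strip, q (z.1, z.2 + (n : ℝ)⁻¹ * c) = q z := by
    intro c hc z hz
    rcases hn' with h | h <;> rw [h]
    · rw [one_mul, hc z hz]
    · have := hc (z.1, z.2 + -1 * c) (translate_mem_strip hz _)
      rw [← this]
      simp
  have hneg' : ∀ c : ℝ, (∀ z ∈ strip, q (1 - z.1, z.2 + c) = q z) →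
      ∀ z ∈ strip, q (1 - z.1, z.2 + (n : ℝ)⁻¹ * c) = q z := by
    intro c hc z hz
    rcases hn' with h | h <;> rw [h]
    · rw [one_mul, hc z hz]
    · have := hc (1 - z.1, z.2 + -1 * c) (reflect_mem_strip hz _)
      rw [← this]
      simp
  have hsq : ∀ c : ℝ, (n : ℝ)⁻¹ * ((n : ℝ)⁻¹ * c) = c := by
    intro c
    rcases hn' with h | h <;> rw [h] <;> ring
  have hFfib : ∀ x ∈ strip, ∀ y ∈ strip, q x = q y → q (F x) = q (F y) := by
    intro x hx y hy hxy
    obtain ⟨c, ⟨rfl, hc⟩ | ⟨rfl, hc⟩⟩ := hq.fiber x hx y hy hxy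
    · rw [hFdef, hΦ.orbitCoords_translate (hq.flow_translate hΦ₀ hΦq hc) hx]
      exact (hneg c hc _ (hF.mem hx)).symm
    · rw [hFdef, hΦ.orbitCoords_reflect (hq.flow_reflect hΦ₀ hΦq hc) hx]
      exact (hneg' c hc _ (hF.mem hx)).symm
  have hGfib : ∀ x ∈ strip, ∀ y ∈ strip, q x = q y → q (G x) = q (G y) := by
    intro x hx y hy hxy
    obtain ⟨c, ⟨rfl, hc⟩ | ⟨rfl, hc⟩⟩ := hq.fiber x hx y hy hxy
    · have hd := hneg c hc
      have h1 := hΦ.orbitCoords_translate (hq.flow_translate hΦ₀ hΦq hd) (hGm x hx)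
      rw [← hFdef, hFG x hx, hsq] at h1
      -- Since `n⁻¹ * n⁻¹ = 1`, `F` sends `G x` translated by `n⁻¹ c` to `x` translated by `c`.
      -- Applying `G` gives its own equivariance.
      rw [← h1, hGF _ (translate_mem_strip (hGm x hx) _), hd _ (hGm x hx)]
    · have hd := hneg' c hc
      have h1 := hΦ.orbitCoords_reflect (hq.flow_reflect hΦ₀ hΦq hd) (hGm x hx)
      rw [← hFdef, hFG x hx, hsq] at h1
      rw [← h1, hGF _ (reflect_mem_strip (hGm x hx) _), hd _ (hGm x hx)]
  obtain ⟨ψ, hψs, hψ⟩ := hq.exists_descend hGs hGm hGfib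
  obtain ⟨φ, hφs, hφ⟩ := hq.exists_descend hF.contDiffOn (fun x hx => hF.mem hx) hFfib
  refine ⟨⟨⟨ψ, φ, fun p => ?_, fun p => ?_⟩, hψs, hφs⟩, fun g p => ?_⟩
  · obtain ⟨x, hx, rfl⟩ := hq.exists_mem p
    rw [hψ x hx, hφ _ (hGm x hx), hFG x hx]
  · obtain ⟨x, hx, rfl⟩ := hq.exists_mem p
    rw [hφ x hx, hψ _ (hF.mem hx), hGF x hx]
  · obtain ⟨x, hx, rfl⟩ := hq.exists_mem p
    obtain ⟨s, rfl⟩ := Circle.exp_surjective g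
    change ψ _ = _ • ψ _
    rw [hrot s x hx, hψ _ (translate_mem_strip hx s), hψ x hx, ← hΦq s _ (hGm x hx)]
    have h1 := hΦ.orbitCoords_apply s (hGm x hx)
    rw [← hFdef, hFG x hx] at h1
    rw [← h1, hGF _ (hΦ.mem s _ (hGm x hx))]

end Action

end StripQuotient

/-! ### Logarithms and lifts for the circle -/

theorem contMDiff_circle_coe {n : WithTop ℕ∞} :
    ContMDiff (𝓡 1) 𝓘(ℝ, ℂ) n (fun z : Circle => (z : ℂ)) :=
  have := Complex.finrank_real_complex_fact
  contMDiff_coe_sphere (E := ℂ)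

/-- The branch of the logarithm on the circle with value `y₀` at `exp y₀`. -/
noncomputable def circleLog (y₀ : ℝ) (z : Circle) : ℝ :=
  y₀ + Complex.arg ((z * Circle.exp (-y₀) : Circle) : ℂ)

theorem exp_circleLog (y₀ : ℝ) (z : Circle) : Circle.exp (circleLog y₀ z) = z := by
  rw [circleLog, Circle.exp_add, Circle.exp_arg, mul_comm, mul_assoc, ← Circle.exp_add,
    neg_add_cancel, Circle.exp_zero, mul_one]

theorem circleLog_exp {y₀ y : ℝ} (h : |y - y₀| < Real.pi) : circleLog y₀ (Circle.exp y) = y := by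
  have h' := abs_lt.mp h
  rw [circleLog, ← Circle.exp_add, ← sub_eq_add_neg, Circle.arg_exp h'.1 h'.2.le]
  ring

/-- The rotation by `-y₀` brings the point to `1`, away from the cut of the logarithm. -/
theorem contMDiffAt_circleLog {n : WithTop ℕ∞} (y₀ : ℝ) :
    ContMDiffAt (𝓡 1) 𝓘(ℝ, ℝ) n (circleLog y₀) (Circle.exp y₀) := by
  have h1 : ContMDiff (𝓡 1) 𝓘(ℝ, ℂ) n fun z : Circle => ((z * Circle.exp (-y₀) : Circle) : ℂ) :=
    contMDiff_circle_coe.comp (contMDiff_id.mul contMDiff_const)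
  have h0 : ((Circle.exp y₀ * Circle.exp (-y₀) : Circle) : ℂ) = 1 := by
    rw [← Circle.exp_add, add_neg_cancel, Circle.exp_zero, Circle.coe_one]
  have h2 : ContDiffAt ℝ n (fun w : ℂ => y₀ + (Complex.log w).im)
      ((Circle.exp y₀ * Circle.exp (-y₀) : Circle) : ℂ) := by
    rw [h0]
    exact contDiffAt_const.add (Complex.imCLM.contDiff.contDiffAt.comp _
      ((Complex.contDiffAt_log Complex.one_mem_slitPlane).restrict_scalars ℝ))
  simp only [Complex.log_im] at h2
  exact ContMDiffAt.comp (g := fun w : ℂ => y₀ + Complex.arg w) (Circle.exp y₀)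
    h2.contMDiffAt h1.contMDiffAt

/-- Lifting of maps to the circle. -/
theorem exists_circle_lift {E : Type*} [NormedAddCommGroup E] [NormedSpace ℝ E] {f : E → Circle}
    (hf : Continuous f) {p₀ : E} {y₀ : ℝ} (h0 : Circle.exp y₀ = f p₀) :
    ∃ g : E → ℝ, Continuous g ∧ (∀ p, Circle.exp (g p) = f p) ∧ g p₀ = y₀ ∧
      ∀ s, ContMDiffOn 𝓘(ℝ, E) (𝓡 1) 1 f s → ContDiffOn ℝ 1 g s := by
  have := RealTopologicalVectorSpace.contractibleSpace (E := E)
  obtain ⟨g, ⟨hg0, hg⟩, -⟩ := Circle.isCoveringMap_exp.existsUnique_continuousMap_lifts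
    ⟨f, hf⟩ p₀ y₀ h0
  have hgf : ∀ p, Circle.exp (g p) = f p := fun p => congrFun hg p
  refine ⟨g, g.continuous, hgf, hg0, fun s hs p hp => ?_⟩
  have h1 : ContMDiffAt (𝓡 1) 𝓘(ℝ, ℝ) 1 (circleLog (g p)) (f p) := by
    rw [← hgf p]
    exact contMDiffAt_circleLog (g p)
  have h2 := (h1.comp_contMDiffWithinAt p (hs p hp)).contDiffWithinAt
  refine h2.congr_of_eventuallyEq_of_mem ?_ hp
  have h3 : ∀ᶠ p' in nhds p, |g p' - g p| < Real.pi := by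
    have hc : Continuous fun p' => |g p' - g p| := (g.continuous.sub continuous_const).abs
    apply (hc.tendsto p).eventually_lt_const
    simpa using Real.pi_pos
  filter_upwards [nhdsWithin_le_nhds h3] with p' hp'
  rw [Function.comp_apply, ← hgf p', circleLog_exp hp']

/-! ### The cylinder as a quotient of the strip -/

/-- The universal covering of the cylinder by the strip, extended to the plane. -/
noncomputable def stripToCylinder (x : ℝ × ℝ) : Cylinder :=
  (Set.projIcc 0 1 zero_le_one x.1, Circle.exp x.2)

theorem continuous_stripToCylinder : Continuous stripToCylinder :=
  (continuous_projIcc.comp continuous_fst).prodMk (Circle.exp.continuous.comp continuous_snd)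

theorem contMDiffOn_stripToCylinder :
    ContMDiffOn 𝓘(ℝ, ℝ × ℝ) cylModel 1 stripToCylinder strip := by
  have h1 : ContMDiffOn 𝓘(ℝ, ℝ × ℝ) (𝓡∂ 1) 1
      (fun x : ℝ × ℝ => Set.projIcc (0 : ℝ) 1 zero_le_one x.1) strip :=
    contMDiffOn_projIcc.comp contDiff_fst.contMDiff.contMDiffOn fun x hx => hx.1
  have h2 : ContMDiffOn 𝓘(ℝ, ℝ × ℝ) (𝓡 1) 1 (fun x : ℝ × ℝ => Circle.exp x.2) strip :=
    (contMDiff_circleExp.comp contDiff_snd.contMDiff).contMDiffOn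
  exact h1.prodMk h2

theorem coe_stripToCylinder_fst {x : ℝ × ℝ} (hx : x ∈ strip) :
    ((stripToCylinder x).1 : ℝ) = x.1 := by
  simp [stripToCylinder, Set.projIcc_of_mem zero_le_one hx.1]

theorem stripToCylinder_eq_iff {x y : ℝ × ℝ} (hx : x ∈ strip) (hy : y ∈ strip) :
    stripToCylinder x = stripToCylinder y ↔ ∃ n : ℤ, y = (x.1, x.2 + n * (2 * Real.pi)) := by
  constructor
  · intro h
    have h1 := congrArg (fun p : Cylinder => (p.1 : ℝ)) h
    simp only [coe_stripToCylinder_fst hx, coe_stripToCylinder_fst hy] at h1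
    obtain ⟨n, hn⟩ := Circle.exp_eq_exp.mp (congrArg Prod.snd h).symm
    exact ⟨n, Prod.ext h1.symm hn⟩
  · rintro ⟨n, rfl⟩
    exact Prod.ext rfl (Circle.exp_eq_exp.mpr ⟨-n, by simp⟩)

theorem stripToCylinder_translate (x : ℝ × ℝ) (n : ℤ) :
    stripToCylinder (x.1, x.2 + n * (2 * Real.pi)) = stripToCylinder x :=
  Prod.ext rfl (Circle.exp_eq_exp.mpr ⟨n, rfl⟩)

theorem cylRotation_stripToCylinder (s : ℝ) (x : ℝ × ℝ) :
    cylRotation (Circle.exp s) (stripToCylinder x) = stripToCylinder (x.1, x.2 + s) :=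
  Prod.ext rfl (by simp [cylRotation, stripToCylinder, Circle.exp_add, mul_comm])

theorem exists_section_stripToCylinder (p : Cylinder) :
    ∃ g : Cylinder → ℝ × ℝ, ContMDiffAt cylModel 𝓘(ℝ, ℝ × ℝ) 1 g p ∧
      ∀ p', g p' ∈ strip ∧ stripToCylinder (g p') = p' := by
  obtain ⟨y, hy⟩ := Circle.exp_surjective p.2
  refine ⟨fun p => (p.1, circleLog y p.2), ?_, fun p' => ⟨⟨p'.1.2, trivial⟩, ?_⟩⟩
  · have h1 : ContMDiff cylModel 𝓘(ℝ, ℝ) 1 (fun p : Cylinder => (p.1 : ℝ)) :=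
      contMDiff_subtypeVal_Icc.comp contMDiff_fst
    have h2 : ContMDiffAt (𝓡 1) 𝓘(ℝ, ℝ) 1 (circleLog y) p.2 := hy ▸ contMDiffAt_circleLog y
    exact h1.contMDiffAt.prodMk_space (h2.comp p contMDiffAt_snd)
  · exact Prod.ext (Set.projIcc_val zero_le_one _) (exp_circleLog _ _)

theorem stripQuotient_cylinder : StripQuotient stripToCylinder where
  continuous := continuous_stripToCylinder
  contMDiffOn := contMDiffOn_stripToCylinder
  exists_section p :=
    let ⟨g, hg, h⟩ := exists_section_stripToCylinder p
    ⟨g, hg, Filter.Eventually.of_forall h⟩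
  int x hx y hy h := by
    obtain ⟨n, rfl⟩ := (stripToCylinder_eq_iff hx hy).mp h
    exact ⟨2 * n, by push_cast; ring⟩
  inj x hx y hy h h2 := by
    have h1 := congrArg (fun p : Cylinder => (p.1 : ℝ)) h
    simp only [coe_stripToCylinder_fst hx, coe_stripToCylinder_fst hy] at h1
    exact Prod.ext h1 h2
  boundary y y' h := by
    obtain ⟨n, hn⟩ := (stripToCylinder_eq_iff (mem_strip_of_boundary (Or.inl rfl))
      (mem_strip_of_boundary (Or.inl rfl))).mp h
    exact ⟨n, (congrArg Prod.snd hn).trans (by ring)⟩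
  translate x _ := by simpa using stripToCylinder_translate x 1
  fiber x hx y hy h := by
    obtain ⟨n, hn⟩ := (stripToCylinder_eq_iff hx hy).mp h
    exact ⟨_, Or.inl ⟨hn, fun z _ => stripToCylinder_translate z n⟩⟩
  lift f hf p₀ x₀ hx₀ h0 := by
    obtain ⟨g, hg, hgf, hg0, hgs⟩ := exists_circle_lift (continuous_snd.comp hf)
      (p₀ := p₀) (y₀ := x₀.2) (congrArg Prod.snd h0)
    refine ⟨fun p => ((f p).1, g p), ?_, fun p => ⟨(f p).1.2, trivial⟩, fun p => ?_, ?_,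
      fun s hs => ?_⟩
    · exact (continuous_subtype_val.comp (continuous_fst.comp hf)).prodMk hg
    · exact Prod.ext (Set.projIcc_val zero_le_one _) (hgf p)
    · dsimp only
      rw [← h0]
      exact Prod.ext (coe_stripToCylinder_fst hx₀) hg0
    · have h1 : ContMDiff cylModel 𝓘(ℝ, ℝ) 1 (fun p : Cylinder => (p.1 : ℝ)) :=
        contMDiff_subtypeVal_Icc.comp contMDiff_fst
      exact (h1.comp_contMDiffOn hs).contDiffOn.prodMk (hgs s (contMDiff_snd.comp_contMDiffOn hs))

/-! ### The Möbius band as a quotient of the strip -/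

namespace Mobius

theorem proj_cylInvol (p : Cylinder) : proj (cylInvol p) = proj p :=
  proj_eq_iff.mpr (Or.inr (cylInvol_cylInvol p).symm)

/-- The point of the cylinder at which the chart of the Möbius band at `m` is centred. -/
noncomputable def chartCenter (m : Mobius) : Cylinder := proj_surjective.hasRightInverse.choose m

theorem proj_chartCenter (m : Mobius) : proj (chartCenter m) = m :=
  proj_surjective.hasRightInverse.choose_spec m

/-- The local inverse of the projection that defines the chart at `m`. -/
noncomputable def localInverse (m : Mobius) : OpenPartialHomeomorph Mobius Cylinder :=
  isLocalHomeomorph_proj.localInverseAt (chartCenter m)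

theorem mem_localInverse_source (m : Mobius) : m ∈ (localInverse m).source := by
  have h := isLocalHomeomorph_proj.apply_self_mem_localInverseAt_source (x := chartCenter m)
  rwa [proj_chartCenter] at h

theorem localInverse_symm (m : Mobius) : ((localInverse m).symm : Cylinder → Mobius) = proj :=
  isLocalHomeomorph_proj.localInverseAt_symm _

theorem localInverse_self (m : Mobius) : localInverse m m = chartCenter m := by
  have h : chartCenter m ∈ (localInverse m).target :=
    isLocalHomeomorph_proj.self_mem_localInverseAt_target
  have h2 := (localInverse m).right_inv h
  rwa [localInverse_symm, proj_chartCenter] at h2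

theorem proj_localInverse {m m' : Mobius} (h : m' ∈ (localInverse m).source) :
    proj (localInverse m m') = m' := by
  rw [← localInverse_symm m]
  exact (localInverse m).left_inv h

theorem extChartAt_apply (m m' : Mobius) :
    extChartAt cylModel m m' = extChartAt cylModel (chartCenter m) (localInverse m m') := rfl

/-- The chart at `m` is the local inverse followed by the chart of the cylinder at the centre.
Undoing the latter expresses the local inverse through charts. -/
theorem contMDiffAt_localInverse (m : Mobius) :
    ContMDiffAt cylModel cylModel 1 (localInverse m) m := by
  have h1 : ContMDiffAt cylModel 𝓘(ℝ, EuclideanSpace ℝ (Fin 1) × EuclideanSpace ℝ (Fin 1)) 1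
      (extChartAt cylModel m) m := contMDiffAt_extChartAt
  have h2 := contMDiffOn_extChartAt_symm (I := cylModel) (n := 1) (chartCenter m)
  have hev : ∀ᶠ m' in nhds m, localInverse m m' ∈ (extChartAt cylModel (chartCenter m)).source := by
    refine ((localInverse m).continuousAt (mem_localInverse_source m)).eventually_mem ?_
    rw [localInverse_self]
    exact extChartAt_source_mem_nhds _
  have hmem : ∀ᶠ m' in nhds m, extChartAt cylModel m m' ∈
      (extChartAt cylModel (chartCenter m)).target := by
    filter_upwards [hev] with m' h
    exact (extChartAt cylModel (chartCenter m)).map_source h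
  have h3 := ((h2 _ hmem.self_of_nhds).comp m h1.contMDiffWithinAt
    (Set.mapsTo_preimage _ _)).contMDiffAt hmem
  refine h3.congr_of_eventuallyEq ?_
  filter_upwards [hev] with m' h
  rw [Function.comp_apply, extChartAt_apply, (extChartAt cylModel (chartCenter m)).left_inv h]

theorem contMDiffAt_proj_chartCenter (m : Mobius) :
    ContMDiffAt cylModel cylModel 1 proj (chartCenter m) := by
  have h1 : ContMDiffAt cylModel 𝓘(ℝ, EuclideanSpace ℝ (Fin 1) × EuclideanSpace ℝ (Fin 1)) 1
      (extChartAt cylModel (chartCenter m)) (chartCenter m) := contMDiffAt_extChartAt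
  have h2 := contMDiffOn_extChartAt_symm (I := cylModel) (n := 1) m
  have hev : ∀ᶠ p in nhds (chartCenter m), p ∈ (localInverse m).target ∧
      proj p ∈ (extChartAt cylModel m).source := by
    refine Filter.Eventually.and ?_ ?_
    · exact (localInverse m).open_target.mem_nhds
        isLocalHomeomorph_proj.self_mem_localInverseAt_target
    · refine continuous_proj.continuousAt.eventually_mem ?_
      rw [proj_chartCenter]
      exact extChartAt_source_mem_nhds _
  have heq : ∀ p ∈ (localInverse m).target,
      extChartAt cylModel (chartCenter m) p = extChartAt cylModel m (proj p) := fun p hp => by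
    rw [extChartAt_apply, ← localInverse_symm m, (localInverse m).right_inv hp]
  have hmem : ∀ᶠ p in nhds (chartCenter m), extChartAt cylModel (chartCenter m) p ∈
      (extChartAt cylModel m).target := by
    filter_upwards [hev] with p h
    rw [heq p h.1]
    exact (extChartAt cylModel m).map_source h.2
  have h3 := ((h2 _ hmem.self_of_nhds).comp (chartCenter m) h1.contMDiffWithinAt
    (Set.mapsTo_preimage _ _)).contMDiffAt hmem
  refine h3.congr_of_eventuallyEq ?_
  filter_upwards [hev] with p h
  rw [Function.comp_apply, heq p h.1, (extChartAt cylModel m).left_inv h.2]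

/-- Each point of the cylinder, or its image under the involution, is the centre of a chart, and the
projection is invariant under the involution. -/
theorem contMDiff_proj : ContMDiff cylModel cylModel 1 proj := by
  intro p
  rcases proj_eq_iff.mp (proj_chartCenter (proj p)).symm with h | h
  · have := contMDiffAt_proj_chartCenter (proj p)
    rwa [h] at this
  · have h1 := contMDiffAt_proj_chartCenter (proj p)
    rw [h] at h1
    have h2 := h1.comp p (contMDiff_cylInvol (n := 1)).contMDiffAt
    exact h2.congr_of_eventuallyEq (Filter.Eventually.of_forall fun p' => (proj_cylInvol p').symm)

/-- A function on the Möbius band is of class `C^1` when its composition with the projection is. -/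
theorem contMDiff_of_comp_proj {E H N : Type*} [NormedAddCommGroup E] [NormedSpace ℝ E]
    [TopologicalSpace H] {I : ModelWithCorners ℝ E H} [TopologicalSpace N] [ChartedSpace H N]
    {f : Mobius → N} (hf : ContMDiff cylModel I 1 (f ∘ proj)) : ContMDiff cylModel I 1 f := by
  intro m
  have h1 := hf.contMDiffAt.comp m (contMDiffAt_localInverse m)
  refine h1.congr_of_eventuallyEq ?_
  filter_upwards [(localInverse m).open_source.mem_nhds (mem_localInverse_source m)] with m' h
  simp only [Function.comp_apply, proj_localInverse h]

/-- The function `[(t, z)] ↦ z²` on the Möbius band. -/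
noncomputable def sqMap : Mobius → Circle :=
  Quotient.lift (fun p : Cylinder => p.2 * p.2) (by
    rintro p q (rfl | rfl)
    · rfl
    · change p.2 * p.2 = (Circle.exp Real.pi * p.2) * (Circle.exp Real.pi * p.2)
      rw [mul_mul_mul_comm, exp_pi_mul_self, one_mul])

theorem sqMap_proj (p : Cylinder) : sqMap (proj p) = p.2 * p.2 := rfl

/-- The function `[(t, z)] ↦ (t - 1/2) z` on the Möbius band. -/
noncomputable def twistMap : Mobius → ℂ :=
  Quotient.lift (fun p : Cylinder => (((p.1 : ℝ) - 1 / 2 : ℝ) : ℂ) * (p.2 : ℂ)) (by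
    rintro p q (rfl | rfl)
    · rfl
    · change _ = (((unitInterval.symm p.1 : ℝ) - 1 / 2 : ℝ) : ℂ) *
        ((Circle.exp Real.pi * p.2 : Circle) : ℂ)
      rw [coe_exp_pi_mul, unitInterval.coe_symm_eq]
      push_cast
      ring)

theorem twistMap_proj (p : Cylinder) :
    twistMap (proj p) = (((p.1 : ℝ) - 1 / 2 : ℝ) : ℂ) * (p.2 : ℂ) := rfl

theorem contMDiff_sqMap : ContMDiff cylModel (𝓡 1) 1 sqMap :=
  contMDiff_of_comp_proj (f := sqMap)
    (show ContMDiff cylModel (𝓡 1) 1 (fun p : Cylinder => p.2 * p.2) from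
      contMDiff_snd.mul contMDiff_snd)

theorem contMDiff_twistMap : ContMDiff cylModel 𝓘(ℝ, ℂ) 1 twistMap := by
  refine contMDiff_of_comp_proj (f := twistMap) ?_
  have h1 : ContMDiff cylModel 𝓘(ℝ, ℝ) 1 (fun p : Cylinder => (p.1 : ℝ)) :=
    contMDiff_subtypeVal_Icc.comp contMDiff_fst
  have h2 : ContMDiff cylModel 𝓘(ℝ, ℂ) 1 (fun p : Cylinder => (p.2 : ℂ)) :=
    contMDiff_circle_coe.comp contMDiff_snd
  have h3 : ContDiff ℝ 1 (fun x : ℝ × ℂ => ((x.1 - 1 / 2 : ℝ) : ℂ) * x.2) :=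
    (Complex.ofRealCLM.contDiff.comp (contDiff_fst.sub contDiff_const)).mul contDiff_snd
  exact h3.contMDiff.comp (h1.prodMk_space h2)

end Mobius

/-- The universal covering of the Möbius band by the strip, extended to the plane. -/
noncomputable def stripToMobius (x : ℝ × ℝ) : Mobius := Mobius.proj (stripToCylinder x)

theorem cylInvol_stripToCylinder {x : ℝ × ℝ} (hx : x ∈ strip) :
    cylInvol (stripToCylinder x) = stripToCylinder (1 - x.1, x.2 + Real.pi) := by
  refine Prod.ext (Subtype.ext ?_) ?_
  · change ((unitInterval.symm (stripToCylinder x).1 : unitInterval) : ℝ) = _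
    rw [unitInterval.coe_symm_eq, coe_stripToCylinder_fst hx,
      coe_stripToCylinder_fst (reflect_mem_strip hx _)]
  · simp [cylInvol, stripToCylinder, Circle.exp_add, mul_comm]

theorem stripToMobius_reflect {x : ℝ × ℝ} (hx : x ∈ strip) (n : ℤ) :
    stripToMobius (1 - x.1, x.2 + (Real.pi + n * (2 * Real.pi))) = stripToMobius x := by
  have h := stripToCylinder_translate (1 - x.1, x.2 + Real.pi) n
  simp only [add_assoc] at h
  rw [stripToMobius, h, ← cylInvol_stripToCylinder hx, Mobius.proj_cylInvol, stripToMobius]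

theorem stripToMobius_fiber {x y : ℝ × ℝ} (hx : x ∈ strip) (hy : y ∈ strip)
    (h : stripToMobius x = stripToMobius y) :
    ∃ n : ℤ, y = (x.1, x.2 + n * (2 * Real.pi)) ∨
      y = (1 - x.1, x.2 + (Real.pi + n * (2 * Real.pi))) := by
  rcases Mobius.proj_eq_iff.mp h with h | h
  · obtain ⟨n, hn⟩ := (stripToCylinder_eq_iff hx hy).mp h.symm
    exact ⟨n, Or.inl hn⟩
  · rw [cylInvol_stripToCylinder hx] at h
    obtain ⟨n, hn⟩ := (stripToCylinder_eq_iff (reflect_mem_strip hx _) hy).mp h.symm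
    exact ⟨n, Or.inr (by rw [hn, add_assoc])⟩

theorem stripToMobius_inj {x y : ℝ × ℝ} (hx : x ∈ strip) (hy : y ∈ strip)
    (h : stripToMobius x = stripToMobius y) (h2 : x.2 = y.2) : x = y := by
  obtain ⟨n, rfl | rfl⟩ := stripToMobius_fiber hx hy h
  · exact Prod.ext rfl h2
  · exfalso
    have h3 : Real.pi * (1 + 2 * n) = 0 := by
      simp only at h2
      linarith
    have h4 : (1 + 2 * n : ℝ) = 0 := (mul_eq_zero.mp h3).resolve_left Real.pi_ne_zero
    have h5 : 1 + 2 * n = 0 := by exact_mod_cast h4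
    omega

/-- The point of the strip above a point `m` of the Möbius band with second coordinate `y`. -/
theorem stripToMobius_eq_of_sqMap {m : Mobius} {y : ℝ} (h : Circle.exp (2 * y) = Mobius.sqMap m) :
    (1 / 2 + (Mobius.twistMap m * Complex.exp (-(y * Complex.I))).re, y) ∈ strip ∧
      stripToMobius (1 / 2 + (Mobius.twistMap m * Complex.exp (-(y * Complex.I))).re, y) = m := by
  have key : ∀ p : Cylinder, p.2 = Circle.exp y → Mobius.proj p = m →
      (1 / 2 + (Mobius.twistMap m * Complex.exp (-(y * Complex.I))).re, y) ∈ strip ∧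
      stripToMobius (1 / 2 + (Mobius.twistMap m * Complex.exp (-(y * Complex.I))).re, y) = m := by
    rintro p hp rfl
    have h1 : 1 / 2 + (Mobius.twistMap (Mobius.proj p) * Complex.exp (-(y * Complex.I))).re =
        (p.1 : ℝ) := by
      rw [Mobius.twistMap_proj, hp, Circle.coe_exp, mul_assoc, ← Complex.exp_add, add_neg_cancel,
        Complex.exp_zero, mul_one, Complex.ofReal_re]
      ring
    rw [h1]
    refine ⟨⟨p.1.2, trivial⟩, congrArg Mobius.proj ?_⟩
    exact Prod.ext (Set.projIcc_val zero_le_one _) hp.symm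
  obtain ⟨p, rfl⟩ := Mobius.proj_surjective m
  rw [two_mul, Circle.exp_add, Mobius.sqMap_proj] at h
  have h2 : ((Circle.exp y : Circle) : ℂ) * (Circle.exp y : Circle) = (p.2 : ℂ) * (p.2 : ℂ) := by
    exact_mod_cast congrArg (fun z : Circle => (z : ℂ)) h
  -- The squares agree, so `p` or its image under the involution has second coordinate `exp y`.
  -- Multiplying `twistMap` by `exp (-iy)` then recovers `t - 1/2`.
  rcases mul_self_eq_mul_self_iff.mp h2 with h3 | h3
  · exact key p (Subtype.ext h3.symm) rfl
  · refine key (cylInvol p) (Subtype.ext ?_) (Mobius.proj_cylInvol p)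
    exact (Mobius.coe_exp_pi_mul p.2).trans h3.symm

/-- For lifting, the angle `z` is not defined on the band but `z²` is. Half of a lift of `z²` gives
the second coordinate, and `(t - 1/2) z`, also well defined, then gives the first by an explicit
smooth formula. -/
theorem stripQuotient_mobius : StripQuotient stripToMobius where
  continuous := Mobius.continuous_proj.comp continuous_stripToCylinder
  contMDiffOn := Mobius.contMDiff_proj.comp_contMDiffOn contMDiffOn_stripToCylinder
  exists_section m := by
    obtain ⟨g, hg, h⟩ := exists_section_stripToCylinder (Mobius.localInverse m m)
    refine ⟨g ∘ Mobius.localInverse m, hg.comp m (Mobius.contMDiffAt_localInverse m), ?_⟩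
    filter_upwards [(Mobius.localInverse m).open_source.mem_nhds
      (Mobius.mem_localInverse_source m)] with m' hm'
    refine ⟨(h _).1, ?_⟩
    rw [stripToMobius, Function.comp_apply, (h _).2, Mobius.proj_localInverse hm']
  int x hx y hy h := by
    obtain ⟨n, rfl | rfl⟩ := stripToMobius_fiber hx hy h
    · exact ⟨2 * n, by push_cast; ring⟩
    · exact ⟨1 + 2 * n, by push_cast; ring⟩
  inj x hx y hy h h2 := stripToMobius_inj hx hy h h2
  boundary y y' h := by
    obtain ⟨n, hn | hn⟩ := stripToMobius_fiber (mem_strip_of_boundary (Or.inl rfl))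
      (mem_strip_of_boundary (Or.inl rfl)) h
    · exact ⟨n, (congrArg Prod.snd hn).trans (by ring)⟩
    · have := congrArg Prod.fst hn
      norm_num at this
  translate x _ := congrArg Mobius.proj (by simpa using stripToCylinder_translate x 1)
  fiber x hx y hy h := by
    obtain ⟨n, hn | hn⟩ := stripToMobius_fiber hx hy h
    · exact ⟨_, Or.inl ⟨hn, fun z _ => congrArg Mobius.proj (stripToCylinder_translate z n)⟩⟩
    · exact ⟨_, Or.inr ⟨hn, fun z hz => stripToMobius_reflect hz n⟩⟩
  lift f hf p₀ x₀ hx₀ h0 := by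
    have hsq : Circle.exp (2 * x₀.2) = Mobius.sqMap (f p₀) := by
      rw [← h0, stripToMobius, Mobius.sqMap_proj, two_mul, Circle.exp_add]
      rfl
    obtain ⟨g, hg, hgf, hg0, hgs⟩ := exists_circle_lift
      (Mobius.contMDiff_sqMap.continuous.comp hf) (p₀ := p₀) hsq
    have hgf' : ∀ p, Circle.exp (2 * (g p / 2)) = Mobius.sqMap (f p) := fun p => by
      rw [mul_div_cancel₀ _ two_ne_zero]
      exact hgf p
    have hE : ContDiff ℝ 1 fun w : ℂ × ℝ =>
        (1 / 2 + (w.1 * Complex.exp (-((w.2 / 2 : ℝ) * Complex.I))).re, w.2 / 2) := by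
      have h1 : ContDiff ℝ 1 fun w : ℂ × ℝ => ((w.2 / 2 : ℝ) : ℂ) :=
        Complex.ofRealCLM.contDiff.comp (contDiff_snd.div_const 2)
      have h2 : ContDiff ℝ 1 fun w : ℂ × ℝ =>
          w.1 * Complex.exp (-((w.2 / 2 : ℝ) * Complex.I)) :=
        contDiff_fst.mul (h1.mul contDiff_const).neg.cexp
      exact (contDiff_const.add (Complex.reCLM.contDiff.comp h2)).prodMk (contDiff_snd.div_const 2)
    refine ⟨fun p => (1 / 2 + (Mobius.twistMap (f p) *
      Complex.exp (-((g p / 2 : ℝ) * Complex.I))).re, g p / 2), ?_,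
      fun p => (stripToMobius_eq_of_sqMap (hgf' p)).1,
      fun p => (stripToMobius_eq_of_sqMap (hgf' p)).2, ?_, fun s hs => ?_⟩
    · exact hE.continuous.comp ((Mobius.contMDiff_twistMap.continuous.comp hf).prodMk hg)
    · obtain ⟨h1, h2⟩ := stripToMobius_eq_of_sqMap (hgf' p₀)
      -- The lift at the base point has the prescribed second coordinate and lies in the same fibre,
      -- so it is `x₀`.
      exact stripToMobius_inj h1 hx₀ (h2.trans h0.symm) (by dsimp only; rw [hg0]; ring)
    · exact hE.comp_contDiffOn
        (((Mobius.contMDiff_twistMap.comp_contMDiffOn hs).contDiffOn).prodMk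
          (hgs s (Mobius.contMDiff_sqMap.comp_contMDiffOn hs)))

theorem mainTheorem9 :
    (∀ [MulAction Circle Cylinder] [FaithfulSMul Circle Cylinder],
      ContMDiff ((𝓡 1).prod cylModel) cylModel 1 (fun x : Circle × Cylinder => x.1 • x.2) →
      MulAction.fixedPoints Circle Cylinder = ∅ →
      ∃ ψ : Diffeomorph cylModel cylModel Cylinder Cylinder 1,
        ∀ (g : Circle) (p : Cylinder), ψ (cylRotation g p) = g • ψ p) ∧
    (∀ [MulAction Circle Mobius] [FaithfulSMul Circle Mobius],
      ContMDiff ((𝓡 1).prod cylModel) cylModel 1 (fun x : Circle × Mobius => x.1 • x.2) →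
      MulAction.fixedPoints Circle Mobius = ∅ →
      ∃ ψ : Diffeomorph cylModel cylModel Mobius Mobius 1,
        ∀ (g : Circle) (p : Mobius), ψ (Mobius.rotation g p) = g • ψ p) := by
  refine ⟨fun hact hfix => ?_, fun hact hfix => ?_⟩
  · exact stripQuotient_cylinder.exists_conjugacy hact hfix cylRotation
      fun s x _ => cylRotation_stripToCylinder s x
  · exact stripQuotient_mobius.exists_conjugacy hact hfix Mobius.rotation
      fun s x _ => congrArg Mobius.proj (cylRotation_stripToCylinder s x)
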